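/- **Setting.** Let $T\subseteq\mathbb Z$ be an infinite index set (for example $\mathbb N$ or $\mathbb Z$); limits and "for $|t|$ large" refer to $t\in T$, $|t|\to\infty$. Let $(a_t,b_t)_{t\in T}$ be integers with $a_t^3\equiv 1 \pmod{b_t}$, $b_t^3\equiv 1\pmod{a_t}$ and $|b_t|>|a_t|>0$ for all $t\in T$, such that the limits $$\tilde a=\lim_{|t|\to\infty}\frac{\log|a_t|}{\log|t|},\qquad \tilde b=\lim_{|t|\to\infty}\frac{\log|b_t|}{\log|t|}$$ exist and satisfy $\tilde a<\frac13$, $\tilde b<1$. Put $$h_t(x)=x^3+\Big(\tfrac{(a_t^3-1)^2-b_t^3}{a_tb_t^2}+t a_t\Big)x^2+\Big(-a_t\tfrac{a_t^3-1}{b_t}-t b_t\Big)x+1$$ and let $\theta_t\in\mathbb R$ be a root of $h_t$, $K_t=\mathbb Q(\theta_t)$, $M_t=\mathbb Z[\theta_t]$. **Definitions.** For an order $M$ in a totally real cubic field $K$ with real embeddings $\sigma_1,\sigma_2,\sigma_3$ (in any order) let $\varphi(\alpha)=(\sigma_i(\alpha))_i$ and $\psi(\alpha)=(\log|\sigma_i(\alpha)|)_i$;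 let $D_M$ be the square of the covolume of $\varphi(M)\subset\mathbb R^3$ and $L_M=D_M^{-1/6}\varphi(M)$, a point of the space $X=\mathrm{SL}_3(\mathbb R)/\mathrm{SL}_3(\mathbb Z)$ of unimodular lattices ($g\,\mathrm{SL}_3(\mathbb Z)$ corresponds to $g\mathbb Z^3$). The height $\mathrm{ht}(L)$ is the inverse of the Euclidean length of a shortest nonzero vector of $L$. Two units of $M$ are a *set of fundamental units* if their images under $\psi$ form a $\mathbb Z$-basis of $\psi(M^\times)$. A *simplex set* is a set $\Phi=\{\alpha_1,\alpha_2,\alpha_3\}$ of vectors with $\sum\alpha_i=0$ that spans $\mathbb R^3_0=\{x:\sum x_i=0\}$; $W_\Phi$ is the set of all $\sum\lambda_i\alpha_i$ with $\{\lambda_1,\lambda_2,\lambda_3\}=\{0,\frac13,\frac23\}$, and $\lceil W_\Phi\rceil$ is the largest coordinate of a point of $W_\Phi$. For $R\ge1$, $0\le r\le1$, a simplex set $\Phi\subseteq\psi(M^\times)$ is *$(R,r)$-tight* if $\exp(r\lceil W_\Phi\rceil)\le R\cdot \mathrm{ht}(L_M)$. Let $A<\mathrm{SL}_3(\mathbb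 R)$ be the group of positive diagonal matrices. A family of compact orbits $Ax_t\subset X$ with $A$-invariant probability measures $\mu_t$ exhibits *$c$-escape of mass* ($0<c\le1$) if every weak-* accumulation point $\mu$ of $(\mu_t)$ as $|t|\to\infty$ satisfies $\mu(X)\le 1-c$; *full escape of mass* is $1$-escape of mass. **Theorem.** 0. For $|t|$ large, $h_t$ is irreducible over $\mathbb Q$ and $K_t$ is a totally real cubic field; the orbits $AL_t$, $L_t=L_{M_t}$, are compact and carry an $A$-invariant probability measure. 1. For $|t|$ large, $\theta_t$ and $a_t\theta_t-b_t$ are a set of fundamental units of $\mathbb Z[\theta_t]$. 2. There are sets $\Phi_t$ which, for $|t|$ large, are simplex sets contained in $\psi(\mathbb Z[\theta_t]^\times)$, such that for every $R\ge1$ and every $0\le r<1$ with $$\tfrac23(1-r)+\big(\tfrac13-r\big)(\tilde a+\tilde b)>0,$$ $\Phi_t$ is $(R,r)$-tight for all $|t|$ large enough (depending on $R$ and $r$). 3. The orbits $AL_t$ exhibit $r^2$-escape of mass as $|t|\to\infty$ for every $r\in(0,1)$ satisfying the inequality in 2. In particular they exhibit $\frac19$-escape of mass, and full escape of mass if $\tilde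 a=\tilde b=0$. -/

import Mathlib

open Filter Topology MeasureTheory Polynomial
open scoped Pointwise IntermediateField CompactlySupported

noncomputable section

/-- Euclidean three-space. -/
abbrev E3 : Type := EuclideanSpace ℝ (Fin 3)

abbrev SL3R : Type := Matrix.SpecialLinearGroup (Fin 3) ℝ

/-- `SL₃(ℤ)` as a subgroup of `SL₃(ℝ)`. -/
abbrev SL3Z : Subgroup SL3R :=
  (Matrix.SpecialLinearGroup.map (n := Fin 3) (Int.castRingHom ℝ)).range

/-- The space `X = SL₃(ℝ) / SL₃(ℤ)`, with the quotient topology and its Borel σ-algebra. -/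
abbrev LatticeSpace : Type := SL3R ⧸ SL3Z

instance : MeasurableSpace LatticeSpace := borel LatticeSpace

instance : BorelSpace LatticeSpace := ⟨rfl⟩

/-- The lattice `g ℤ³`, i.e. the integer span of the columns of `g`. -/
def columnLattice (g : SL3R) : Submodule ℤ E3 :=
  Submodule.span ℤ (Set.range fun j : Fin 3 => (WithLp.toLp 2 fun i : Fin 3 => g.1 i j : E3))

theorem mk_eq_of_columnLattice_eq {g h : SL3R} (e : columnLattice g = columnLattice h) :
    (g : LatticeSpace) = (h : LatticeSpace) := by
  have key : ∀ j : Fin 3, ∃ n : Fin 3 → ℤ,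
      ∑ k, n k • (WithLp.toLp 2 fun i : Fin 3 => g.1 i k : E3)
        = (WithLp.toLp 2 fun i : Fin 3 => h.1 i j : E3) := by
    intro j
    have hj : (WithLp.toLp 2 fun i : Fin 3 => h.1 i j : E3) ∈ columnLattice g := by
      rw [e]
      exact Submodule.subset_span ⟨j, rfl⟩
    exact (Submodule.mem_span_range_iff_exists_fun ℤ).1 hj
  choose n hn using key
  let N : Matrix (Fin 3) (Fin 3) ℤ := Matrix.of fun k j => n j k
  have hmul : h.1 = g.1 * N.map (Int.castRingHom ℝ) := by
    ext i j
    have := congrArg (fun v : E3 => v i) (hn j)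
    simp only [Matrix.mul_apply, N, Matrix.map_apply, Matrix.of_apply]
    simpa [mul_comm] using this.symm
  have hdet : N.det = 1 := by
    have h1 : (N.map (Int.castRingHom ℝ)).det = 1 := by
      have := congrArg Matrix.det hmul
      rw [Matrix.det_mul, g.2, h.2, one_mul] at this
      exact this.symm
    have h2 : ((N.det : ℤ) : ℝ) = 1 := by
      rw [← h1]
      exact RingHom.map_det (Int.castRingHom ℝ) N
    exact_mod_cast h2
  rw [QuotientGroup.eq]
  refine ⟨⟨N, hdet⟩, ?_⟩
  rw [eq_inv_mul_iff_mul_eq]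
  apply Subtype.ext
  exact hmul.symm

open Classical in
/-- The point `g SL₃(ℤ)` of `X` that corresponds to the unimodular lattice `L = g ℤ³`.
It does not depend on the choice of `g`, see `pointOf_columnLattice`. -/
def pointOf (L : Submodule ℤ E3) : LatticeSpace :=
  if h : ∃ g : SL3R, columnLattice g = L then (h.choose : LatticeSpace)
  else ((1 : SL3R) : LatticeSpace)

theorem pointOf_columnLattice (g : SL3R) : pointOf (columnLattice g) = (g : LatticeSpace) := by
  have h : ∃ g' : SL3R, columnLattice g' = columnLattice g := ⟨g, rfl⟩
  rw [pointOf, dif_pos h]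
  exact mk_eq_of_columnLattice_eq h.choose_spec

/-- The height of a lattice: the inverse of the length of a shortest nonzero vector. -/
def latticeHeight (L : Submodule ℤ E3) : ℝ :=
  (sInf {s : ℝ | ∃ v ∈ L, v ≠ 0 ∧ s = ‖v‖})⁻¹

/-- The group `A` of positive diagonal matrices in `SL₃(ℝ)`. -/
def posDiag : Set SL3R := {g | g.1.IsDiag ∧ ∀ i, 0 < g.1 i i}

/-- The orbit `A x`. -/
def diagOrbit (x : LatticeSpace) : Set LatticeSpace := (fun g : SL3R => g • x) '' posDiag

/-- `μ` is an `A`-invariant probability measure carried by the orbit `A x`. If `A x` is compact,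
this is the periodic measure of that orbit. -/
structure IsOrbitMeasure (x : LatticeSpace) (μ : Measure LatticeSpace) : Prop where
  prob : IsProbabilityMeasure μ
  invariant : ∀ g ∈ posDiag, μ.map (fun y => g • y) = μ
  carried : μ (diagOrbit x)ᶜ = 0

/-- `ν` is a weak-* accumulation point of the family `μ` along `l`: as functionals on `C_c(X)`,
with the topology of pointwise convergence. -/
def IsWeakStarAccPt {ι : Type*} (l : Filter ι) (μ : ι → Measure LatticeSpace)
    (ν : Measure LatticeSpace) : Prop :=
  MapClusterPt (fun f : C_c(LatticeSpace, ℝ) => ∫ y, f y ∂ν) l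
    (fun i (f : C_c(LatticeSpace, ℝ)) => ∫ y, f y ∂(μ i))

/-- The family of orbits `A (x i)` exhibits `c`-escape of mass along `l`: every weak-* accumulation
point of the orbit measures has total mass at most `1 - c`. -/
def EscapeOfMass {ι : Type*} (l : Filter ι) (x : ι → LatticeSpace) (c : ℝ) : Prop :=
  ∀ μ : ι → Measure LatticeSpace, (∀ᶠ i in l, IsOrbitMeasure (x i) (μ i)) →
    ∀ ν : Measure LatticeSpace, IsFiniteMeasureOnCompacts ν → IsWeakStarAccPt l μ ν →
      ν Set.univ ≤ ENNReal.ofReal (1 - c)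

section Orders

variable {K : Type*} [Field K] (σ : Fin 3 → (K →+* ℝ)) (O : Subalgebra ℤ K)

/-- The map `φ : K → ℝ³`, `α ↦ (σ₁ α, σ₂ α, σ₃ α)`. -/
def realEmbedding : K →ₗ[ℤ] E3 where
  toFun α := WithLp.toLp 2 fun i => σ i α
  map_add' x y := by ext i; simp
  map_smul' n x := by ext i; simp

/-- The lattice `φ(O)`. -/
def orderLattice : Submodule ℤ E3 := (Subalgebra.toSubmodule O).map (realEmbedding σ)

/-- The discriminant: the square of the covolume of `φ(O)`. -/
def orderDisc : ℝ := ZLattice.covolume (orderLattice σ O) ^ 2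

/-- The unimodular lattice `D ^ (-1/6) φ(O)`. -/
def unimodularLattice : Submodule ℤ E3 :=
  (orderDisc σ O ^ (-(1 / 6) : ℝ)) • orderLattice σ O

/-- The map `ψ`, `α ↦ (log |σ₁ α|, log |σ₂ α|, log |σ₃ α|)`. -/
def logEmbedding (α : K) : E3 := WithLp.toLp 2 fun i => Real.log |σ i α|

/-- The units of the ring `O`, as elements of `K`. -/
def unitSet : Set K := {α | ∃ u : Oˣ, ((u : O) : K) = α}

/-- `α₁, α₂` are units of `O` whose images under `ψ` form a `ℤ`-basis of `ψ(Oˣ)`. -/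
structure IsFundamentalSystem (α : Fin 2 → K) : Prop where
  mem : ∀ j, α j ∈ unitSet O
  indep : LinearIndependent ℤ fun j => logEmbedding σ (α j)
  span : (Submodule.span ℤ (Set.range fun j => logEmbedding σ (α j)) : Set E3) =
    logEmbedding σ '' unitSet O

end Orders

/-- A simplex set: three vectors with sum zero that span `ℝ³₀ = {x : x₁ + x₂ + x₃ = 0}`. -/
structure IsSimplexSet (Φ : Fin 3 → E3) : Prop where
  span : (Submodule.span ℝ (Set.range Φ) : Set E3) = {x | ∑ i, x i = 0}
  sum : ∑ i, Φ i = 0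

/-- The set `W_Φ` of all `∑ λᵢ Φᵢ` with `{λ₁, λ₂, λ₃} = {0, 1/3, 2/3}`. -/
def simplexVertices (Φ : Fin 3 → E3) : Set E3 :=
  {v | ∃ c : Fin 3 → ℝ, Set.range c = {0, 1 / 3, 2 / 3} ∧ v = ∑ i, c i • Φ i}

/-- The largest coordinate that occurs among the points of `W_Φ`. -/
def simplexCeil (Φ : Fin 3 → E3) : ℝ :=
  sSup ((fun v : E3 => ⨆ i : Fin 3, v i) '' simplexVertices Φ)

/-- `Φ` is a simplex set consisting of vectors of `ψ(Oˣ)`. -/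
def IsUnitSimplexSet {K : Type*} [Field K] (σ : Fin 3 → (K →+* ℝ)) (O : Subalgebra ℤ K)
    (Φ : Fin 3 → E3) : Prop :=
  IsSimplexSet Φ ∧ ∀ i, Φ i ∈ logEmbedding σ '' unitSet O

/-- The inequality that makes a simplex set `Φ ⊆ ψ(Oˣ)` an `(R, r)`-tight one. -/
def IsTight {K : Type*} [Field K] (σ : Fin 3 → (K →+* ℝ)) (O : Subalgebra ℤ K)
    (R r : ℝ) (Φ : Fin 3 → E3) : Prop :=
  Real.exp (r * simplexCeil Φ) ≤ latticeHeight (unimodularLattice σ O) * R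

/-- `(a, b)` is a mutually cubic root pair: `a³ ≡ 1 (mod b)` and `b³ ≡ 1 (mod a)`. -/
def IsMutuallyCubicRootPair (a b : ℤ) : Prop := a ^ 3 ≡ 1 [ZMOD b] ∧ b ^ 3 ≡ 1 [ZMOD a]

/-- The polynomial `x³ + P x² + Q x + 1` with `P = ((a³ - 1)² - b³) / (a b²) + t a` and
`Q = -a (a³ - 1) / b - t b`. -/
def cubicPoly (a b t : ℤ) : ℚ[X] :=
  X ^ 3 + C ((((a : ℚ) ^ 3 - 1) ^ 2 - (b : ℚ) ^ 3) / ((a : ℚ) * (b : ℚ) ^ 2) + t * a) * X ^ 2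
    + C (-(a : ℚ) * (((a : ℚ) ^ 3 - 1) / (b : ℚ)) - t * b) * X + 1

/-- The root `θ` as an element of the field `ℚ(θ)`. -/
abbrev rootGen (θ : ℝ) : ℚ⟮θ⟯ := IntermediateField.AdjoinSimple.gen ℚ θ

/-- The ring `ℤ[θ]` inside the field `ℚ(θ)`. -/
def rootOrder (θ : ℝ) : Subalgebra ℤ ℚ⟮θ⟯ := Algebra.adjoin ℤ {rootGen θ}

end

/-! Write `L, A, B` for the logarithms of `|t|, |a|, |b|`. For large `t` the cubic has a root of
size about `|t a|` and one of size about `1 / |t b|`, so the third has size about `|b / a|`, because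
the product of the roots is `-1`. The coefficients are made so that `a³ h(b / a) = 1`, which makes
`aθ - b` a unit next to `θ`. Up to bounded errors and the order of the embeddings, the log vectors
of the two units are `u = (L + A, B - A, -L - B)` and `v = (L + 2A, -L - 2A - B, B)`, and the root
of the discriminant is at least a constant times `t² |a b|` (`IsLogModel`,
`IsLargeParameter.exists_isLogModel`).

Fundamental units. For a unit `α` of `ℤ[θ]` with nonzero log vector, the Vandermonde determinant of
its conjugates is a nonzero integer multiple of that of `θ` (`IsCubicDatum.unit_vandermonde`). If
the coordinates of the log vector are close to each other, this determinant is too small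
(`IsCubicDatum.abs_conjVandermonde_lt`). Hence the log lattice has no nonzero point in a hexagon of
area `3 m²`, with `m` about `2L + A + B`. Minkowski's theorem bounds its covolume below, and
comparison with the determinant of `u, v` forces the index of their span to be less than `2`
(`exists_int_combination_of_hexagon`, `IsLogModel.det_small`).

Escape of mass. A point of the orbit is `exp(y) L_t` with `y` of coordinate sum zero, and each unit
`α` gives it a vector with coordinates `± exp(y_i + ψ(α)_i) D^(-1/6)`. Take `y` to be a combination
of `u` and `-v` and use units to remove the integer parts of its coefficients. If the remainder lies
in the `r`-scaled copy of a hexagon that tiles the plane by `ℤ²`, all exponents are at most `r (2L/3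
+ A + B) + O(1)` (`IsLogModel.combination_le`). The inequality on `r` says that `log D / 6`, which
is at least `(2L + A + B) / 3 - O(1)`, wins by a positive multiple of `L`. So the vector tends to
zero and the lattice leaves every compact set. The scaled hexagon has area `r²`, so a proportion of
at least `r²` of the orbit escapes (`IsOrbitMeasure.measure_le`). The vertices of the tile are the
points of `W_Φ` for `Φ = {u, -v, v - u}`, hence the same estimate at `r = 1` gives tightness. -/

noncomputable section

/-! ### The plane, the integer lattice and hexagons -/

/-- The lattice `ℤ²` in `ℝ²`. -/
abbrev intLattice : Submodule ℤ (Fin 2 → ℝ) :=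
  Submodule.span ℤ (Set.range (Pi.basisFun ℝ (Fin 2)))

/-- The unit square `[0, 1)²`. -/
abbrev unitSquare : Set (Fin 2 → ℝ) := ZSpan.fundamentalDomain (Pi.basisFun ℝ (Fin 2))

theorem mem_intLattice {w : Fin 2 → ℝ} : w ∈ intLattice ↔ ∀ i, ∃ n : ℤ, (n : ℝ) = w i := by
  rw [intLattice, Module.Basis.mem_span_iff_repr_mem]
  simp

theorem mem_unitSquare {w : Fin 2 → ℝ} : w ∈ unitSquare ↔ ∀ i, w i ∈ Set.Ico (0 : ℝ) 1 := by
  rw [unitSquare, ZSpan.mem_fundamentalDomain]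
  simp

instance : Countable intLattice.toAddSubgroup :=
  inferInstanceAs (Countable (Submodule.span ℤ (Set.range (Pi.basisFun ℝ (Fin 2)))))

theorem measurableSet_unitSquare : MeasurableSet unitSquare :=
  ZSpan.fundamentalDomain_measurableSet _

theorem isAddFundamentalDomain_unitSquare :
    IsAddFundamentalDomain intLattice.toAddSubgroup unitSquare volume :=
  ZSpan.isAddFundamentalDomain' _ _

theorem volume_unitSquare : volume unitSquare = 1 := by
  rw [unitSquare, ZSpan.fundamentalDomain_pi_basisFun, Real.volume_pi_Ico]
  simp

/-- The slice over first coordinate `p` is an interval of length `2m - |p|`, and the integral of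
this over `(-m, m)` is `4m² - m²`. -/
theorem volume_hexagon {m : ℝ} (hm : 0 ≤ m) :
    volume {w : Fin 2 → ℝ | |w 0| < m ∧ |w 1| < m ∧ |w 0 - w 1| < m} =
      ENNReal.ofReal (3 * m ^ 2) := by
  let f : ℝ → ℝ := fun p => max (-m) (p - m)
  let g : ℝ → ℝ := fun p => min m (p + m)
  have hS : {w : Fin 2 → ℝ | |w 0| < m ∧ |w 1| < m ∧ |w 0 - w 1| < m} =
      MeasurableEquiv.finTwoArrow (α := ℝ) ⁻¹' regionBetween f g (Set.Ioo (-m) m) := by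
    ext w
    simp only [regionBetween, f, g, Set.mem_ofPred_eq, Set.mem_preimage,
      MeasurableEquiv.finTwoArrow_apply, Set.mem_Ioo, abs_lt, max_lt_iff, lt_min_iff]
    constructor
    · rintro ⟨⟨h1, h2⟩, ⟨h3, h4⟩, h5, h6⟩
      refine ⟨⟨h1, h2⟩, ⟨h3, ?_⟩, h4, ?_⟩ <;> linarith
    · rintro ⟨⟨h1, h2⟩, ⟨h3, h4⟩, h5, h6⟩
      refine ⟨⟨h1, h2⟩, ⟨h3, h5⟩, ?_, ?_⟩ <;> linarith
  have hf : Continuous f := by fun_prop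
  have hg : Continuous g := by fun_prop
  have hgf : ∀ p ∈ Set.Ioo (-m) m, g p - f p = 2 * m - |p| := by
    intro p hp
    rcases le_total 0 p with h | h
    · rw [abs_of_nonneg h]
      simp only [f, g]
      rw [max_eq_right (by linarith), min_eq_left (by linarith)]
      ring
    · rw [abs_of_nonpos h]
      simp only [f, g]
      rw [max_eq_left (by linarith), min_eq_right (by linarith)]
      ring
  rw [hS, (volume_preserving_finTwoArrow ℝ).measure_preimage_equiv]
  have hvol : (volume : Measure (ℝ × ℝ)) = (volume : Measure ℝ).prod volume := rfl
  rw [hvol, volume_regionBetween_eq_integral]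
  · congr 1
    rw [setIntegral_congr_fun (f := g - f) (g := fun p => 2 * m - |p|) measurableSet_Ioo
        (fun p hp => hgf p hp),
      ← integral_Ioc_eq_integral_Ioo, ← intervalIntegral.integral_of_le (by linarith),
      ← intervalIntegral.integral_add_adjacent_intervals (b := 0)]
    · have h1 : ∫ x in (-m)..0, (2 * m - |x|) = ∫ x in (-m)..0, (2 * m + x) := by
        apply intervalIntegral.integral_congr
        intro x hx
        rw [Set.uIcc_of_le (by linarith)] at hx
        simp [abs_of_nonpos hx.2]
      have h2 : ∫ x in (0)..m, (2 * m - |x|) = ∫ x in (0)..m, (2 * m - x) := by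
        apply intervalIntegral.integral_congr
        intro x hx
        rw [Set.uIcc_of_le (by linarith)] at hx
        simp [abs_of_nonneg hx.1]
      rw [h1, h2, intervalIntegral.integral_add (by simp) (by simp),
        intervalIntegral.integral_sub (by simp) (by simp)]
      simp
      ring
    · exact Continuous.intervalIntegrable (by fun_prop) _ _
    · exact Continuous.intervalIntegrable (by fun_prop) _ _
  · exact (hf.continuousOn.integrableOn_Icc (a := -m) (b := m)).mono_set Set.Ioo_subset_Icc_self
  · exact (hg.continuousOn.integrableOn_Icc (a := -m) (b := m)).mono_set Set.Ioo_subset_Icc_self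
  · exact measurableSet_Ioo
  · intro p hp
    have := hgf p hp
    have h2 : |p| < m := abs_lt.2 ⟨hp.1, hp.2⟩
    have h3 : 0 ≤ g p - f p := by rw [this]; linarith
    linarith

/-- The hexagon whose translates by `ℤ²` tile the plane, scaled by `r`. -/
def tileHexagon (r : ℝ) : Set (Fin 2 → ℝ) :=
  {w | |w 0 + w 1| < r ∧ |2 * w 0 - w 1| < r ∧ |w 0 - 2 * w 1| < r}

theorem isOpen_tileHexagon (r : ℝ) : IsOpen (tileHexagon r) := by
  refine (isOpen_lt (f := fun w : Fin 2 → ℝ => |w 0 + w 1|) (by fun_prop) continuous_const).inter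
    ((isOpen_lt (f := fun w : Fin 2 → ℝ => |2 * w 0 - w 1|) (by fun_prop) continuous_const).inter
    (isOpen_lt (f := fun w : Fin 2 → ℝ => |w 0 - 2 * w 1|) (by fun_prop) continuous_const))

/-- The map `w ↦ (w 0 + w 1, 2 w 0 - w 1)` has determinant `-3` and carries the tile onto the
hexagon of area `3 r²`; the third linear form is, up to sign, the difference of the first two. -/
theorem volume_tileHexagon {r : ℝ} (hr : 0 ≤ r) :
    volume (tileHexagon r) = ENNReal.ofReal (r ^ 2) := by
  let M : Matrix (Fin 2) (Fin 2) ℝ := !![1, 1; 2, -1]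
  have hdet : LinearMap.det (Matrix.toLin' M) = -3 := by
    rw [LinearMap.det_toLin', Matrix.det_fin_two]
    simp [M]
    norm_num
  have hS : tileHexagon r = Matrix.toLin' M ⁻¹'
      {w : Fin 2 → ℝ | |w 0| < r ∧ |w 1| < r ∧ |w 0 - w 1| < r} := by
    ext w
    have h : (w 0 + w 1) - (2 * w 0 - w 1) = -(w 0 - 2 * w 1) := by ring
    simp only [tileHexagon, M, Set.mem_ofPred_eq, Set.mem_preimage, Matrix.toLin'_apply,
      Matrix.mulVec, Matrix.of_apply, dotProduct, Fin.sum_univ_two, Matrix.cons_val_zero,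
      Matrix.cons_val_one]
    rw [← abs_neg (w 0 - 2 * w 1), ← h]
    simp [sub_eq_add_neg]
  rw [hS, Measure.addHaar_preimage_linearMap _ (by rw [hdet]; norm_num), volume_hexagon hr, hdet,
    ← ENNReal.ofReal_mul (abs_nonneg _)]
  congr 1
  rw [abs_of_neg (by norm_num)]
  ring

/-- Integer translates of the tile are disjoint: for an integer difference `(a, b)` the three forms
are integers of absolute value at most `1`, and `3a = (a + b) + (2a - b)`, `3b = (a + b) - (a -
2b)`. -/
theorem eq_of_sub_mem_tileHexagon {r : ℝ} (hr : r ≤ 1) {v w n : Fin 2 → ℝ}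
    (hv : v ∈ tileHexagon r) (hw : w ∈ tileHexagon r) (hn : n ∈ intLattice) (h : n = v - w) :
    n = 0 := by
  rw [mem_intLattice] at hn
  obtain ⟨a, ha⟩ := hn 0
  obtain ⟨b, hb⟩ := hn 1
  obtain ⟨hv1, hv2, hv3⟩ := hv
  obtain ⟨hw1, hw2, hw3⟩ := hw
  have e0 : (a : ℝ) = v 0 - w 0 := by rw [ha, h]; rfl
  have e1 : (b : ℝ) = v 1 - w 1 := by rw [hb, h]; rfl
  rw [abs_lt] at hv1 hv2 hv3 hw1 hw2 hw3
  have i1 : (-2 : ℝ) < a + b := by linarith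
  have i2 : (a + b : ℝ) < 2 := by linarith
  have i3 : (-2 : ℝ) < 2 * a - b := by linarith
  have i4 : (2 * a - b : ℝ) < 2 := by linarith
  have i5 : (-2 : ℝ) < a - 2 * b := by linarith
  have i6 : (a - 2 * b : ℝ) < 2 := by linarith
  norm_cast at i1 i2 i3 i4 i5 i6
  have ha0 : a = 0 := by omega
  have hb0 : b = 0 := by omega
  ext i
  fin_cases i
  · simp [← ha, ha0]
  · simp [← hb, hb0]

/-- A set that contains all integer translates of a scaled tile fills a proportion of at least
`r²` of the unit square. -/
theorem le_volume_inter_unitSquare {r : ℝ} (hr0 : 0 ≤ r) (hr : r ≤ 1) (w₀ : Fin 2 → ℝ)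
    {S : Set (Fin 2 → ℝ)}
    (hS : ∀ n ∈ intLattice, ∀ w, w - n + w₀ ∈ tileHexagon r → w ∈ S) :
    ENNReal.ofReal (r ^ 2) ≤ volume (S ∩ unitSquare) := by
  let t : Set (Fin 2 → ℝ) := (fun w => w + w₀) ⁻¹' tileHexagon r
  have ht : volume t = ENNReal.ofReal (r ^ 2) := by
    rw [measure_preimage_add_right, volume_tileHexagon hr0]
  have htm : MeasurableSet t :=
    ((isOpen_tileHexagon r).preimage (by fun_prop)).measurableSet
  have hmem : ∀ (g : intLattice.toAddSubgroup) (w : Fin 2 → ℝ),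
      w ∈ g +ᵥ t ↔ w - g + w₀ ∈ tileHexagon r := by
    intro g w
    rw [Set.mem_vadd_set_iff_neg_vadd_mem]
    have : (-g : intLattice.toAddSubgroup) +ᵥ w = w - g := by
      rw [AddSubgroup.vadd_def]
      simp [sub_eq_neg_add]
    rw [this]
    rfl
  -- The tile is cut along the translates of the unit square. Moved back into the square, the pieces
  -- are disjoint and lie in `S`.
  rw [← ht, isAddFundamentalDomain_unitSquare.measure_eq_tsum t, ← measure_iUnion]
  · apply measure_mono
    apply Set.iUnion_subset
    rintro g w ⟨hw, hw'⟩
    exact ⟨hS g g.2 w ((hmem g w).1 hw), hw'⟩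
  · intro g g' hgg
    refine Set.disjoint_left.2 ?_
    rintro w ⟨hw, -⟩ ⟨hw', -⟩
    apply hgg
    have := eq_of_sub_mem_tileHexagon hr ((hmem g w).1 hw) ((hmem g' w).1 hw')
      (n := (g' - g : intLattice.toAddSubgroup)) (g' - g).2 (by simp)
    have h2 : g' - g = 0 := Subtype.ext this
    exact (sub_eq_zero.1 h2).symm
  · intro g
    exact (htm.const_vadd g).inter measurableSet_unitSquare

/-! ### The space of lattices and the diagonal flow -/

instance : LocallyCompactSpace SL3R :=
  haveI : LocallyCompactSpace (Matrix (Fin 3) (Fin 3) ℝ) :=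
    inferInstanceAs (LocallyCompactSpace (Fin 3 → Fin 3 → ℝ))
  Matrix.SpecialLinearGroup.isClosedEmbedding_val.locallyCompactSpace

instance : SecondCountableTopology SL3R :=
  haveI : SecondCountableTopology (Matrix (Fin 3) (Fin 3) ℝ) :=
    inferInstanceAs (SecondCountableTopology (Fin 3 → Fin 3 → ℝ))
  Matrix.SpecialLinearGroup.isClosedEmbedding_val.isEmbedding.secondCountableTopology

instance : IsClosed (SL3Z : Set SL3R) := by
  rw [MonoidHom.coe_range]
  exact (Int.isClosedEmbedding_coe_real.specialLinearGroup_map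
    (f := Int.castRingHom ℝ) (n := Fin 3)).isClosed_range

/-- The positive diagonal matrix of determinant one with diagonal proportional to `exp (y i)`. -/
def diagExp (y : E3) : SL3R :=
  ⟨Matrix.diagonal fun i => Real.exp (y i - (∑ j, y j) / 3), by
    rw [Matrix.det_diagonal, ← Real.exp_sum, Finset.sum_sub_distrib]
    simp [mul_div_cancel₀]⟩

theorem diagExp_add (y z : E3) : diagExp (y + z) = diagExp y * diagExp z := by
  apply Subtype.ext
  change Matrix.diagonal _ = Matrix.diagonal _ * Matrix.diagonal _
  rw [Matrix.diagonal_mul_diagonal]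
  congr 1
  ext i
  rw [← Real.exp_add]
  congr 1
  simp only [PiLp.add_apply, Finset.sum_add_distrib]
  ring

theorem diagExp_apply {y : E3} (hy : ∑ j, y j = 0) :
    (diagExp y).1 = Matrix.diagonal fun i => Real.exp (y i) := by
  simp [diagExp, hy]

theorem continuous_diagExp : Continuous diagExp := by
  refine continuous_induced_rng.2 ?_
  change Continuous fun y : E3 => Matrix.diagonal fun i => Real.exp (y i - (∑ j, y j) / 3)
  fun_prop

theorem diagExp_mem_posDiag (y : E3) : diagExp y ∈ posDiag :=
  ⟨Matrix.isDiag_diagonal _, fun i => by simp [diagExp, Real.exp_pos]⟩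

theorem exists_diagExp_of_mem_posDiag {g : SL3R} (hg : g ∈ posDiag) :
    ∃ y : E3, ∑ j, y j = 0 ∧ diagExp y = g := by
  obtain ⟨hd, hp⟩ := hg
  have hsum : ∑ j, Real.log (g.1 j j) = 0 := by
    rw [← Real.log_prod (fun i _ => (hp i).ne'), ← Matrix.det_diagonal,
      show Matrix.diagonal (fun j => g.1 j j) = g.1 from hd.diagonal_diag, g.2, Real.log_one]
  refine ⟨WithLp.toLp 2 fun i => Real.log (g.1 i i), hsum, ?_⟩
  apply Subtype.ext
  rw [diagExp_apply hsum]
  simp only [Real.exp_log (hp _)]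
  exact hd.diagonal_diag

/-- The action of `ℝ²` through the diagonal matrices `exp (w₀ U + w₁ V)`. -/
def flow (U V : E3) (w : Fin 2 → ℝ) : SL3R := diagExp (w 0 • U + w 1 • V)

theorem flow_add (U V : E3) (v w : Fin 2 → ℝ) : flow U V (v + w) = flow U V v * flow U V w := by
  rw [flow, flow, flow, ← diagExp_add]
  congr 1
  simp only [Pi.add_apply, add_smul]
  abel

theorem continuous_flow (U V : E3) : Continuous (flow U V) :=
  continuous_diagExp.comp (by fun_prop)

theorem flow_mem_posDiag (U V : E3) (w : Fin 2 → ℝ) : flow U V w ∈ posDiag :=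
  diagExp_mem_posDiag _

theorem flow_zero (U V : E3) : flow U V 0 = 1 := by
  have := flow_add U V 0 0
  simpa using this

theorem exists_flow_of_mem_posDiag {U V : E3}
    (hUV : ∀ y : E3, ∑ j, y j = 0 → ∃ w : Fin 2 → ℝ, y = w 0 • U + w 1 • V)
    {g : SL3R} (hg : g ∈ posDiag) : ∃ w, flow U V w = g := by
  obtain ⟨y, hy, rfl⟩ := exists_diagExp_of_mem_posDiag hg
  obtain ⟨w, rfl⟩ := hUV y hy
  exact ⟨w, rfl⟩

theorem mem_diagOrbit_iff_flow {U V : E3}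
    (hUV : ∀ y : E3, ∑ j, y j = 0 → ∃ w : Fin 2 → ℝ, y = w 0 • U + w 1 • V)
    {x z : LatticeSpace} : z ∈ diagOrbit x ↔ ∃ w, flow U V w • x = z := by
  constructor
  · rintro ⟨g, hg, rfl⟩
    obtain ⟨w, rfl⟩ := exists_flow_of_mem_posDiag hUV hg
    exact ⟨w, rfl⟩
  · rintro ⟨w, rfl⟩
    exact ⟨_, flow_mem_posDiag U V w, rfl⟩

theorem flow_smul_of_mem_intLattice {U V : E3} {x : LatticeSpace}
    (hU : diagExp U • x = x) (hV : diagExp V • x = x) {n : Fin 2 → ℝ} (hn : n ∈ intLattice) :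
    flow U V n • x = x := by
  induction hn using Submodule.span_induction with
  | mem w hw =>
    obtain ⟨i, rfl⟩ := hw
    fin_cases i
    · simpa [flow] using hU
    · simpa [flow] using hV
  | zero => simp [flow_zero]
  | add v w _ _ hv hw => rw [flow_add, mul_smul, hw, hv]
  | smul k w _ hw =>
    have hneg : ∀ w, flow U V w • x = x → flow U V (-w) • x = x := by
      intro w hw
      have : flow U V (-w) • (flow U V w • x) = x := by
        rw [← mul_smul, ← flow_add, neg_add_cancel, flow_zero, one_smul]
      rwa [hw] at this
    have hnat : ∀ k : ℕ, flow U V (k • w) • x = x := by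
      intro k
      induction k with
      | zero => simp [flow_zero]
      | succ k ih => rw [succ_nsmul, flow_add, mul_smul, hw, ih]
    obtain ⟨k, rfl | rfl⟩ := k.eq_nat_or_neg
    · simpa using hnat k
    · simpa using hneg _ (hnat k)

theorem exists_sub_mem_unitSquare (w : Fin 2 → ℝ) :
    ∃ n ∈ intLattice, w - n ∈ unitSquare := by
  refine ⟨ZSpan.floor (Pi.basisFun ℝ (Fin 2)) w, SetLike.coe_mem _, ?_⟩
  exact ZSpan.fract_mem_fundamentalDomain _ w

section Periodic

variable {U V : E3} {x : LatticeSpace}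

theorem continuous_flow_smul (U V : E3) (x : LatticeSpace) :
    Continuous fun w => flow U V w • x :=
  (continuous_flow U V).smul continuous_const

/-- An orbit of the diagonal group with two independent periods is compact. -/
theorem isCompact_diagOrbit
    (hUV : ∀ y : E3, ∑ j, y j = 0 → ∃ w : Fin 2 → ℝ, y = w 0 • U + w 1 • V)
    (hU : diagExp U • x = x) (hV : diagExp V • x = x) : IsCompact (diagOrbit x) := by
  have hc : IsCompact (Set.Icc (0 : Fin 2 → ℝ) 1) := isCompact_Icc
  have : diagOrbit x = (fun w => flow U V w • x) '' Set.Icc (0 : Fin 2 → ℝ) 1 := by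
    ext z
    rw [mem_diagOrbit_iff_flow hUV]
    constructor
    · rintro ⟨w, rfl⟩
      obtain ⟨n, hn, hw⟩ := exists_sub_mem_unitSquare w
      rw [mem_unitSquare] at hw
      refine ⟨w - n, ⟨fun i => (hw i).1, fun i => (hw i).2.le⟩, ?_⟩
      have : w = (w - n) + n := by abel
      conv_rhs => rw [this, flow_add, mul_smul, flow_smul_of_mem_intLattice hU hV hn]
    · rintro ⟨w, -, rfl⟩
      exact ⟨w, rfl⟩
  rw [this]
  exact hc.image (continuous_flow_smul U V x)

/-- An orbit of the diagonal group with two independent periods carries an invariant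
probability measure. -/
theorem exists_isOrbitMeasure
    (hUV : ∀ y : E3, ∑ j, y j = 0 → ∃ w : Fin 2 → ℝ, y = w 0 • U + w 1 • V)
    (hU : diagExp U • x = x) (hV : diagExp V • x = x) : ∃ μ, IsOrbitMeasure x μ := by
  let F : (Fin 2 → ℝ) → LatticeSpace := fun w => flow U V w • x
  have hF : Measurable F := (continuous_flow_smul U V x).measurable
  refine ⟨(volume.restrict unitSquare).map F, ⟨?_⟩, ?_, ?_⟩
  · rw [Measure.map_apply hF MeasurableSet.univ]
    rw [Set.preimage_univ, Measure.restrict_apply_univ, volume_unitSquare]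
  · intro g hg
    obtain ⟨c, rfl⟩ := exists_flow_of_mem_posDiag hUV hg
    have hg' : Measurable fun y : LatticeSpace => flow U V c • y :=
      (continuous_const_smul _).measurable
    rw [Measure.map_map hg' hF]
    ext s hs
    rw [Measure.map_apply (hg'.comp hF) hs, Measure.map_apply hF hs,
      Measure.restrict_apply (hg'.comp hF hs), Measure.restrict_apply (hF hs)]
    have hpre : (fun y : LatticeSpace => flow U V c • y) ∘ F ⁻¹' s =
        (fun w => c + w) ⁻¹' (F ⁻¹' s) := by
      ext w
      simp [F, flow_add, mul_smul]
    have hD : IsAddFundamentalDomain intLattice.toAddSubgroup (c +ᵥ unitSquare)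
        (volume : Measure (Fin 2 → ℝ)) :=
      isAddFundamentalDomain_unitSquare.vadd_of_comm c
    -- Acting by `flow U V c` shifts the unit square by `c`. A `ℤ²`-periodic set has the same area
    -- in every fundamental domain, which gives invariance.
    have hinv : volume (F ⁻¹' s ∩ (c +ᵥ unitSquare)) = volume (F ⁻¹' s ∩ unitSquare) := by
      refine hD.measure_set_eq isAddFundamentalDomain_unitSquare (hF hs) ?_
      rintro ⟨n, hn⟩
      ext w
      have : (⟨n, hn⟩ : intLattice.toAddSubgroup) +ᵥ w = w + n := by
        rw [AddSubgroup.vadd_def]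
        simp [add_comm]
      simp only [Set.mem_preimage, this, F]
      rw [flow_add, mul_smul, flow_smul_of_mem_intLattice hU hV hn]
    rw [← hinv, hpre, ← measure_preimage_add volume c (F ⁻¹' s ∩ (c +ᵥ unitSquare)),
      Set.preimage_inter]
    congr 2
    ext w
    simp [Set.mem_vadd_set_iff_neg_vadd_mem]
  · have hs : F ⁻¹' (diagOrbit x)ᶜ = ∅ := by
      ext w
      simp only [Set.mem_preimage, Set.mem_compl_iff, Set.mem_empty_iff_false, iff_false, not_not]
      exact (mem_diagOrbit_iff_flow hUV).2 ⟨w, rfl⟩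
    rw [Measure.map_apply hF
      (isCompact_diagOrbit hUV hU hV).isClosed.measurableSet.compl, hs]
    simp

end Periodic

/-- If the integer translates of a scaled tile leave the compact set `K`, then `K` has small
measure with respect to any invariant measure of the orbit. -/
theorem IsOrbitMeasure.measure_le {U V : E3} {x : LatticeSpace}
    (hUV : ∀ y : E3, ∑ j, y j = 0 → ∃ w : Fin 2 → ℝ, y = w 0 • U + w 1 • V)
    {μ : Measure LatticeSpace} (hμ : IsOrbitMeasure x μ) {K : Set LatticeSpace}
    (hK : MeasurableSet K) {r : ℝ} (hr0 : 0 ≤ r) (hr : r ≤ 1)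
    (h : ∀ n ∈ intLattice, ∀ w ∈ tileHexagon r, flow U V (w + n) • x ∉ K) :
    μ K ≤ ENNReal.ofReal (1 - r ^ 2) := by
  have := hμ.prob
  let P : Measure (Fin 2 → ℝ) := volume.restrict unitSquare
  have hP : P Set.univ = 1 := by rw [Measure.restrict_apply_univ, volume_unitSquare]
  let S : Set ((Fin 2 → ℝ) × LatticeSpace) := {q | flow U V q.1 • q.2 ∈ K}
  have hc : Continuous fun q : (Fin 2 → ℝ) × LatticeSpace => flow U V q.1 • q.2 :=
    ((continuous_flow U V).comp continuous_fst).smul continuous_snd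
  have hS : MeasurableSet S := hc.measurable hK
  have : IsFiniteMeasure P := ⟨by rw [hP]; simp⟩
  -- Averaging over the flow: by invariance each slice at fixed `w` has mass `μ K`. Fubini then
  -- replaces `μ K` by the proportion of the unit square that sends a point of the orbit into `K`.
  -- The integer vectors need not be periods of the orbit for this.
  have h1 : (P.prod μ) S = μ K := by
    rw [Measure.prod_apply hS]
    have : ∀ w, μ (Prod.mk w ⁻¹' S) = μ K := by
      intro w
      conv_rhs => rw [← hμ.invariant _ (flow_mem_posDiag U V w)]
      rw [Measure.map_apply (continuous_const_smul _).measurable hK]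
      rfl
    simp only [this, lintegral_const, hP, mul_one]
  rw [← h1, Measure.prod_apply_symm hS]
  have h2 : ∀ᵐ y ∂μ, P ((fun w => (w, y)) ⁻¹' S) ≤ ENNReal.ofReal (1 - r ^ 2) := by
    have hcar : ∀ᵐ y ∂μ, y ∈ diagOrbit x := hμ.carried
    filter_upwards [hcar] with y hy
    obtain ⟨w₀, rfl⟩ := (mem_diagOrbit_iff_flow hUV).1 hy
    let T : Set (Fin 2 → ℝ) := (fun w => (w, flow U V w₀ • x)) ⁻¹' S
    have hT : MeasurableSet T := hS.preimage (by fun_prop)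
    have h3 : ENNReal.ofReal (r ^ 2) ≤ P Tᶜ := by
      rw [Measure.restrict_apply hT.compl]
      refine le_volume_inter_unitSquare hr0 hr w₀ ?_
      intro n hn w hw hwT
      refine h n hn _ hw ?_
      have : w - n + w₀ + n = w + w₀ := by abel
      rw [this, flow_add, mul_smul]
      exact hwT
    have h4 : P T + P Tᶜ = 1 := by rw [measure_add_measure_compl hT, hP]
    have h5 : P T = 1 - P Tᶜ := by
      rw [← h4, ENNReal.add_sub_cancel_right (measure_ne_top _ _)]
    change P T ≤ _
    rw [h5, ENNReal.ofReal_sub _ (by positivity), ENNReal.ofReal_one]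
    exact tsub_le_tsub_left h3 1
  calc ∫⁻ y, P ((fun w => (w, y)) ⁻¹' S) ∂μ ≤ ∫⁻ _, ENNReal.ofReal (1 - r ^ 2) ∂μ :=
        lintegral_mono_ae h2
    _ = ENNReal.ofReal (1 - r ^ 2) := by simp

/-- To show escape of mass, it is enough to bound the mass of each compact set. -/
theorem escapeOfMass_of_forall_isCompact {ι : Type*} {l : Filter ι} {x : ι → LatticeSpace}
    {c : ℝ} (hc : c ≤ 1)
    (h : ∀ K : Set LatticeSpace, IsCompact K → ∀ᶠ i in l, ∀ μ, IsOrbitMeasure (x i) μ →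
      μ K ≤ ENNReal.ofReal (1 - c)) : EscapeOfMass l x c := by
  intro μ hμ ν hν hacc
  have key : ∀ K : Set LatticeSpace, IsCompact K → ν K ≤ ENNReal.ofReal (1 - c) := by
    intro K hK
    -- Weak-* accumulation only sees continuous functions of compact support, so `K` is dominated by
    -- a bump function and the hypothesis is applied to its support.
    obtain ⟨f, hf1, -, hfc, hf01⟩ :=
      exists_continuous_one_zero_of_isCompact hK isClosed_empty (Set.disjoint_empty K)
    let F : C_c(LatticeSpace, ℝ) := ⟨f, hfc⟩
    have hev : ∀ᶠ i in l, ∫ y, F y ∂(μ i) ≤ 1 - c := by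
      filter_upwards [h (tsupport f) hfc, hμ] with i hi hμi
      have := hμi.prob
      have hle : ∫ y, F y ∂(μ i) ≤ ∫ y, (tsupport f).indicator 1 y ∂(μ i) := by
        refine integral_mono_of_nonneg (ae_of_all _ fun y => (hf01 y).1) ?_ (ae_of_all _ ?_)
        · exact (integrable_const (1 : ℝ)).indicator hfc.isClosed.measurableSet
        · intro y
          by_cases hy : y ∈ tsupport f
          · simp only [Set.indicator_of_mem hy]
            exact (hf01 y).2
          · simp only [Set.indicator_of_notMem hy]
            exact (image_eq_zero_of_notMem_tsupport hy).le
      rw [integral_indicator_one hfc.isClosed.measurableSet] at hle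
      refine hle.trans ?_
      exact ENNReal.toReal_le_of_le_ofReal (by linarith) (hi _ hμi)
    have hcl : ∫ y, F y ∂ν ≤ 1 - c := by
      have h1 : MapClusterPt (∫ y, F y ∂ν) l fun i => ∫ y, F y ∂(μ i) :=
        hacc.continuousAt_comp
          (f := fun φ : C_c(LatticeSpace, ℝ) → ℝ => φ F) (continuous_apply F).continuousAt
      exact isClosed_Iic.mem_of_mapClusterPt h1 hev
    have hint : Integrable F ν := F.continuous.integrable_of_hasCompactSupport F.hasCompactSupport
    calc ν K ≤ ∫⁻ y, ENNReal.ofReal (F y) ∂ν := by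
          rw [← lintegral_indicator_one hK.measurableSet]
          refine lintegral_mono fun y => ?_
          by_cases hy : y ∈ K
          · have : F y = 1 := hf1 hy
            simp [hy, this]
          · simp [hy]
      _ = ENNReal.ofReal (∫ y, F y ∂ν) :=
          (ofReal_integral_eq_lintegral_ofReal hint (ae_of_all _ fun y => (hf01 y).1)).symm
      _ ≤ ENNReal.ofReal (1 - c) := ENNReal.ofReal_le_ofReal hcl
  have hU : ν Set.univ = ⨆ n, ν (compactCovering LatticeSpace n) := by
    rw [← iUnion_compactCovering LatticeSpace]
    exact Monotone.measure_iUnion fun _ _ h => compactCovering_subset _ h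
  rw [hU]
  exact iSup_le fun n => key _ (isCompact_compactCovering _ n)

/-! ### Short vectors -/

theorem columnLattice_eq_of_mk_eq {g h : SL3R} (e : (g : LatticeSpace) = (h : LatticeSpace)) :
    columnLattice g = columnLattice h := by
  have aux : ∀ g h : SL3R, (g : LatticeSpace) = (h : LatticeSpace) →
      columnLattice h ≤ columnLattice g := by
    intro g h e
    obtain ⟨N, hN⟩ := QuotientGroup.eq.1 e
    have hh : h.1 = g.1 * N.1.map (Int.castRingHom ℝ) :=
      congrArg Subtype.val ((eq_inv_mul_iff_mul_eq.1 hN).symm)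
    rw [columnLattice, Submodule.span_le]
    rintro _ ⟨j, rfl⟩
    refine (Submodule.mem_span_range_iff_exists_fun ℤ).2 ⟨fun k => N.1 k j, ?_⟩
    ext i
    rw [hh]
    simp [Matrix.mul_apply, mul_comm]
  exact le_antisymm (aux h g e.symm) (aux g h e)

/-- The sum of the absolute values of the entries of the inverse matrix. -/
def invSize (g : SL3R) : ℝ := ∑ i, ∑ j, |(g⁻¹).1 i j|

theorem continuous_invSize : Continuous invSize := by
  have : Continuous fun g : SL3R => (g⁻¹).1 := continuous_subtype_val.comp continuous_inv
  unfold invSize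
  fun_prop

/-- The entries of `g⁻¹ v` are integers, not all zero, so one of them has absolute value at least
`1`. -/
theorem one_le_invSize_mul_norm {g : SL3R} {v : E3} (hv : v ∈ columnLattice g) (h0 : v ≠ 0) :
    1 ≤ invSize g * ‖v‖ := by
  obtain ⟨n, rfl⟩ := (Submodule.mem_span_range_iff_exists_fun ℤ).1 hv
  set v : E3 := ∑ i, n i • (WithLp.toLp 2 fun k : Fin 3 => g.1 k i : E3) with hvdef
  have hvec : (fun i => v i) = g.1.mulVec (fun i => (n i : ℝ)) := by
    ext i
    simp [hvdef, Matrix.mulVec, dotProduct, mul_comm]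
  have hn : (g⁻¹).1.mulVec (fun i => v i) = fun i => (n i : ℝ) := by
    rw [hvec, Matrix.mulVec_mulVec, ← Matrix.SpecialLinearGroup.coe_mul]
    simp
  obtain ⟨k, hk⟩ : ∃ k, n k ≠ 0 := by
    by_contra! hall
    apply h0
    simp [hvdef, hall]
  have h1 : (1 : ℝ) ≤ |(n k : ℝ)| := by exact_mod_cast Int.one_le_abs hk
  have h2 : (n k : ℝ) = ∑ j, (g⁻¹).1 k j * v j := (congrFun hn k).symm
  calc (1 : ℝ) ≤ |∑ j, (g⁻¹).1 k j * v j| := by rw [← h2]; exact h1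
    _ ≤ ∑ j, |(g⁻¹).1 k j * v j| := Finset.abs_sum_le_sum_abs _ _
    _ ≤ ∑ j, |(g⁻¹).1 k j| * ‖v‖ := by
        refine Finset.sum_le_sum fun j _ => ?_
        rw [abs_mul]
        exact mul_le_mul_of_nonneg_left (PiLp.norm_apply_le v j) (abs_nonneg _)
    _ = (∑ j, |(g⁻¹).1 k j|) * ‖v‖ := (Finset.sum_mul _ _ _).symm
    _ ≤ invSize g * ‖v‖ := by
        refine mul_le_mul_of_nonneg_right ?_ (norm_nonneg _)
        exact Finset.single_le_sum (f := fun i => ∑ j, |(g⁻¹).1 i j|)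
          (fun i _ => Finset.sum_nonneg fun j _ => abs_nonneg _) (Finset.mem_univ k)

/-- On a compact set of lattices, the nonzero vectors are bounded away from zero. -/
theorem exists_le_norm_of_isCompact {K : Set LatticeSpace} (hK : IsCompact K) :
    ∃ ε > 0, ∀ g : SL3R, (g : LatticeSpace) ∈ K → ∀ v ∈ columnLattice g, v ≠ 0 → ε ≤ ‖v‖ := by
  -- An increasing open cover of the quotient by lattices having some representative with a bounded
  -- inverse; compactness selects one bound for all of `K`.
  let O : ℕ → Set LatticeSpace := fun n => (fun g : SL3R => (g : LatticeSpace)) ''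
    {g | invSize g < n}
  have hO : ∀ n, IsOpen (O n) := fun n =>
    QuotientGroup.isOpenMap_coe _ (isOpen_lt continuous_invSize continuous_const)
  have hcov : K ⊆ ⋃ n, O n := by
    intro z _
    obtain ⟨g, rfl⟩ := QuotientGroup.mk_surjective z
    obtain ⟨n, hn⟩ := exists_nat_gt (invSize g)
    exact Set.mem_iUnion.2 ⟨n, g, hn, rfl⟩
  have hmono : Monotone O := by
    intro m n hmn
    refine Set.image_mono fun g hg => ?_
    exact lt_of_lt_of_le (α := ℝ) hg (by exact_mod_cast hmn)
  obtain ⟨n, hn⟩ := hK.elim_directed_cover O hO hcov hmono.directed_le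
  refine ⟨1 / ((n : ℝ) + 1), by positivity, ?_⟩
  intro g hg v hv h0
  obtain ⟨g', hg', he⟩ := hn hg
  rw [← columnLattice_eq_of_mk_eq he] at hv
  have h1 := one_le_invSize_mul_norm hv h0
  have h2 : invSize g' ≤ n + 1 := by
    have : invSize g' < n := hg'
    linarith
  rw [div_le_iff₀ (by positivity), mul_comm]
  exact h1.trans (mul_le_mul_of_nonneg_right h2 (norm_nonneg _))

/-- The height of a unimodular lattice is at least the inverse of the length of any nonzero
vector. -/
theorem inv_norm_le_latticeHeight {g : SL3R} {v : E3} (hv : v ∈ columnLattice g) (h0 : v ≠ 0) :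
    ‖v‖⁻¹ ≤ latticeHeight (columnLattice g) := by
  have hv' : 0 < ‖v‖ := norm_pos_iff.2 h0
  have hC : 0 < invSize g := by
    have := one_le_invSize_mul_norm hv h0
    by_contra hcon
    nlinarith
  have hlow : ∀ s ∈ {s : ℝ | ∃ v ∈ columnLattice g, v ≠ 0 ∧ s = ‖v‖}, (invSize g)⁻¹ ≤ s := by
    rintro s ⟨w, hw, hw0, rfl⟩
    rw [inv_le_iff_one_le_mul₀ hC, mul_comm]
    exact one_le_invSize_mul_norm hw hw0
  have hpos : 0 < sInf {s : ℝ | ∃ v ∈ columnLattice g, v ≠ 0 ∧ s = ‖v‖} :=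
    lt_of_lt_of_le (inv_pos.2 hC) (le_csInf ⟨_, v, hv, h0, rfl⟩ hlow)
  exact inv_anti₀ hpos (csInf_le ⟨_, hlow⟩ ⟨v, hv, h0, rfl⟩)

/-! ### Lattices without points in a hexagon -/

theorem convex_hexagon (m : ℝ) :
    Convex ℝ {w : Fin 2 → ℝ | |w 0| < m ∧ |w 1| < m ∧ |w 0 - w 1| < m} := by
  have key : ∀ f : (Fin 2 → ℝ) →ₗ[ℝ] ℝ, Convex ℝ {w : Fin 2 → ℝ | |f w| < m} := by
    intro f
    have : {w : Fin 2 → ℝ | |f w| < m} = f ⁻¹' Metric.ball 0 m := by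
      ext w
      simp
    rw [this]
    exact (convex_ball 0 m).linear_preimage f
  have h2 : Convex ℝ {w : Fin 2 → ℝ | |w 0 - w 1| < m} := by
    simpa only [LinearMap.sub_apply, LinearMap.proj_apply] using
      key ((LinearMap.proj 0 : (Fin 2 → ℝ) →ₗ[ℝ] ℝ) - (LinearMap.proj 1 : (Fin 2 → ℝ) →ₗ[ℝ] ℝ))
  exact (key (LinearMap.proj 0)).inter ((key (LinearMap.proj 1)).inter h2)

/-- If a group of vectors in the plane has no nonzero element in a hexagon, two of its elements
that span a parallelogram of small area generate the group. -/
theorem exists_int_combination_of_hexagon {m : ℝ} (hm : 0 < m) (Γ : AddSubgroup (Fin 2 → ℝ))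
    (hΓ : ∀ w ∈ Γ, |w 0| < m → |w 1| < m → |w 0 - w 1| < m → w = 0)
    {u v : Fin 2 → ℝ} (hu : u ∈ Γ) (hv : v ∈ Γ) (hdet : u 0 * v 1 - u 1 * v 0 ≠ 0)
    (hsmall : 2 * |u 0 * v 1 - u 1 * v 0| < 3 * m ^ 2) {w : Fin 2 → ℝ} (hw : w ∈ Γ) :
    ∃ a b : ℤ, w = a • u + b • v := by
  let Γ' : Submodule ℤ (Fin 2 → ℝ) := AddSubgroup.toIntSubmodule Γ
  let Λ : Submodule ℤ (Fin 2 → ℝ) := Submodule.span ℤ (Set.range ![u, v])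
  have hdet' : (Matrix.of ![u, v]).det = u 0 * v 1 - u 1 * v 0 := by
    rw [Matrix.det_fin_two]
    simp
  have hli : LinearIndependent ℝ ![u, v] := by
    have := (Matrix.linearIndependent_rows_iff_isUnit (A := Matrix.of ![u, v])).2
      ((Matrix.isUnit_iff_isUnit_det _).2 (by rw [hdet']; exact hdet.isUnit))
    exact this
  have hspan : Submodule.span ℝ (Set.range ![u, v]) = ⊤ :=
    hli.span_eq_top_of_card_eq_finrank (by simp)
  have hle : Λ ≤ Γ' := by
    rw [Submodule.span_le]
    rintro _ ⟨i, rfl⟩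
    fin_cases i
    · exact hu
    · exact hv
  -- The hexagon contains the ball of radius `m / 2` in the sup norm.
  have hd : DiscreteTopology Γ' := by
    rw [discreteTopology_iff_isOpen_singleton_zero, Metric.isOpen_singleton_iff]
    refine ⟨m / 2, by positivity, ?_⟩
    rintro ⟨z, hz⟩ hdist
    have hz2 : ‖z‖ < m / 2 := by simpa using hdist
    have h0 : |z 0| < m / 2 := (norm_le_pi_norm z 0).trans_lt hz2
    have h1 : |z 1| < m / 2 := (norm_le_pi_norm z 1).trans_lt hz2
    have h2 : |z 0 - z 1| ≤ |z 0| + |z 1| := abs_sub _ _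
    exact Subtype.ext (hΓ z hz (by linarith) (by linarith) (by linarith))
  have hd' : DiscreteTopology Λ := DiscreteTopology.of_subset hd hle
  have hz' : IsZLattice ℝ Λ := ⟨by
    rw [eq_top_iff, ← hspan]
    exact Submodule.span_mono Submodule.subset_span⟩
  have hz : IsZLattice ℝ Γ' := ⟨by
    rw [eq_top_iff, ← hspan]
    exact Submodule.span_mono (Submodule.subset_span.trans hle)⟩
  have hcovΛ : ZLattice.covolume Λ = |u 0 * v 1 - u 1 * v 0| := by
    have hliZ : LinearIndependent ℤ ![u, v] := hli.restrict_scalars' ℤ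
    let b := Module.Basis.span hliZ
    rw [ZLattice.covolume_eq_det Λ b, ← hdet']
    congr 3
    ext i : 1
    exact congrArg Subtype.val (Module.Basis.span_apply hliZ i)
  -- Minkowski: a symmetric convex set of area greater than `4` times the covolume would contain a
  -- nonzero lattice point.
  have hcovΓ : 3 * m ^ 2 ≤ 4 * ZLattice.covolume Γ' := by
    by_contra! hcon
    let b := Module.Free.chooseBasis ℤ Γ'
    have hfund := ZLattice.isAddFundamentalDomain b volume
    have hcov := ZLattice.covolume_eq_measure_fundamentalDomain Γ' volume hfund
    have : Countable Γ'.toAddSubgroup := inferInstanceAs (Countable Γ')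
    have hfin : volume (ZSpan.fundamentalDomain (b.ofZLatticeBasis ℝ)) ≠ ⊤ :=
      (Bornology.IsBounded.measure_lt_top (ZSpan.fundamentalDomain_isBounded _)).ne
    obtain ⟨⟨z, hzΓ⟩, hz0, hzs⟩ := exists_ne_zero_mem_lattice_of_measure_mul_two_pow_lt_measure
      (L := Γ'.toAddSubgroup) hfund
      (s := {w : Fin 2 → ℝ | |w 0| < m ∧ |w 1| < m ∧ |w 0 - w 1| < m})
      (by
        rintro z ⟨h1, h2, h3⟩
        refine ⟨by simpa using h1, by simpa using h2, ?_⟩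
        rw [← abs_neg]
        simpa [add_comm, sub_eq_add_neg] using h3)
      (convex_hexagon m)
      (by
        rw [volume_hexagon hm.le, ← ENNReal.ofReal_toReal hfin]
        change ENNReal.ofReal (volume.real _) * _ < _
        rw [← hcov]
        have : (2 : ENNReal) ^ Module.finrank ℝ (Fin 2 → ℝ) = ENNReal.ofReal 4 := by
          rw [Module.finrank_fin_fun, ENNReal.ofReal_ofNat]
          norm_num
        rw [this, ← ENNReal.ofReal_mul (ZLattice.covolume_pos Γ' volume).le]
        exact (ENNReal.ofReal_lt_ofReal_iff (by positivity)).2 (by linarith))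
    exact hz0 (Subtype.ext (hΓ z hzΓ hzs.1 hzs.2.1 hzs.2.2))
  have hidx := ZLattice.covolume_div_covolume_eq_relIndex Λ Γ' hle
  have hpos := ZLattice.covolume_pos Γ' volume
  have hposΛ := ZLattice.covolume_pos Λ volume
  have h1 : (0 : ℝ) < (Λ.toAddSubgroup.relIndex Γ'.toAddSubgroup : ℕ) := by
    rw [← hidx]
    exact div_pos hposΛ hpos
  -- The index is a quotient of covolumes; a positive integer below `2` is `1`.
  have h2 : ((Λ.toAddSubgroup.relIndex Γ'.toAddSubgroup : ℕ) : ℝ) < 2 := by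
    rw [← hidx, div_lt_iff₀ hpos, hcovΛ]
    linarith
  have h3 : Λ.toAddSubgroup.relIndex Γ'.toAddSubgroup = 1 := by
    have h1' : 0 < Λ.toAddSubgroup.relIndex Γ'.toAddSubgroup := by exact_mod_cast h1
    have h2' : Λ.toAddSubgroup.relIndex Γ'.toAddSubgroup < 2 := by exact_mod_cast h2
    omega
  have hwΛ : w ∈ Λ := AddSubgroup.relIndex_eq_one.1 h3 hw
  obtain ⟨c, hc⟩ := (Submodule.mem_span_range_iff_exists_fun ℤ).1 hwΛ
  exact ⟨c 0, c 1, by simpa [Fin.sum_univ_two] using hc.symm⟩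

/-! ### Cubic orders with three real embeddings -/

/-- The polynomial `x³ + P x² + Q x + 1` over `ℚ`. -/
def unitCubic (P Q : ℤ) : ℚ[X] := X ^ 3 + C (P : ℚ) * X ^ 2 + C (Q : ℚ) * X + 1

theorem unitCubic_eq (P Q : ℤ) : unitCubic P Q =
    C 1 * X ^ 3 + C (P : ℚ) * X ^ 2 + C (Q : ℚ) * X + C 1 := by
  simp [unitCubic]

theorem natDegree_unitCubic (P Q : ℤ) : (unitCubic P Q).natDegree = 3 := by
  rw [unitCubic_eq]
  exact natDegree_cubic one_ne_zero

theorem monic_unitCubic (P Q : ℤ) : (unitCubic P Q).Monic := by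
  rw [Monic, unitCubic_eq, leadingCoeff_cubic one_ne_zero]

theorem aeval_unitCubic {A : Type*} [CommRing A] [Algebra ℚ A] (P Q : ℤ) (x : A) :
    aeval x (unitCubic P Q) = x ^ 3 + P * x ^ 2 + Q * x + 1 := by
  simp [unitCubic]

/-- A rational root is an integer dividing the constant term, so it is `1` or `-1`, where the cubic
takes the values `P + Q + 2` and `P - Q`. -/
theorem unitCubic_no_rational_root {P Q : ℤ} (h1 : P + Q + 2 ≠ 0) (h2 : P ≠ Q) (x : ℚ) :
    x ^ 3 + P * x ^ 2 + Q * x + 1 ≠ 0 := by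
  intro hx
  have hint : IsIntegral ℤ x := by
    refine ⟨X ^ 3 + C P * X ^ 2 + C Q * X + 1, ?_, ?_⟩
    · have : (X ^ 3 + C P * X ^ 2 + C Q * X + 1 : ℤ[X]) =
          C 1 * X ^ 3 + C P * X ^ 2 + C Q * X + C 1 := by simp
      rw [Monic, this, leadingCoeff_cubic one_ne_zero]
    · simp only [eval₂_add, eval₂_mul, eval₂_C, eval₂_X, eval₂_pow, eval₂_one]
      simpa using hx
  obtain ⟨n, rfl⟩ := IsIntegrallyClosed.isIntegral_iff.1 hint
  simp only [algebraMap_int_eq, eq_intCast] at hx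
  have hn : n ^ 3 + P * n ^ 2 + Q * n + 1 = 0 := by exact_mod_cast hx
  have hunit : IsUnit n := by
    refine IsUnit.of_mul_eq_one (-(n ^ 2 + P * n + Q)) ?_
    linear_combination -hn
  rcases Int.isUnit_iff.1 hunit with rfl | rfl
  · exact h1 (by linear_combination hn)
  · exact h2 (by linear_combination hn)

theorem irreducible_unitCubic {P Q : ℤ}
    (h : ∀ x : ℚ, x ^ 3 + P * x ^ 2 + Q * x + 1 ≠ 0) : Irreducible (unitCubic P Q) := by
  rw [(monic_unitCubic P Q).irreducible_iff_roots_eq_zero_of_degree_le_three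
    (by rw [natDegree_unitCubic]; norm_num) (by rw [natDegree_unitCubic])]
  rw [Multiset.eq_zero_iff_forall_notMem]
  intro x hx
  refine h x ?_
  rw [← aeval_unitCubic, coe_aeval_eq_eval]
  exact (mem_roots'.1 hx).2

/-- `σ` is injective, `θ` is a root of `x³ + P x² + Q x + 1`, and this polynomial has no rational
root. -/
structure IsCubicDatum (θ : ℝ) (P Q : ℤ) (σ : Fin 3 → (ℚ⟮θ⟯ →+* ℝ)) : Prop where
  root : θ ^ 3 + P * θ ^ 2 + Q * θ + 1 = 0
  no_rat : ∀ x : ℚ, x ^ 3 + P * x ^ 2 + Q * x + 1 ≠ 0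
  inj : Function.Injective σ

theorem isIntegral_of_root {θ : ℝ} {P Q : ℤ} (h : θ ^ 3 + P * θ ^ 2 + Q * θ + 1 = 0) :
    IsIntegral ℚ θ :=
  ⟨unitCubic P Q, monic_unitCubic P Q, by rw [← aeval_def, aeval_unitCubic, h]⟩

theorem minpoly_eq_unitCubic {θ : ℝ} {P Q : ℤ} (h : θ ^ 3 + P * θ ^ 2 + Q * θ + 1 = 0)
    (hn : ∀ x : ℚ, x ^ 3 + P * x ^ 2 + Q * x + 1 ≠ 0) : minpoly ℚ θ = unitCubic P Q :=
  (minpoly.eq_of_irreducible_of_monic (irreducible_unitCubic hn)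
    (by rw [aeval_unitCubic, h]) (monic_unitCubic P Q)).symm

/-- If the cubic splits over the reals, then there are three real embeddings. -/
theorem card_ringHom_eq_three {θ : ℝ} {P Q : ℤ} (h : θ ^ 3 + P * θ ^ 2 + Q * θ + 1 = 0)
    (hn : ∀ x : ℚ, x ^ 3 + P * x ^ 2 + Q * x + 1 ≠ 0) {r₁ r₂ r₃ : ℝ}
    (hr : ∀ x : ℝ, x ^ 3 + P * x ^ 2 + Q * x + 1 = (x - r₁) * (x - r₂) * (x - r₃)) :
    Nat.card (ℚ⟮θ⟯ →+* ℝ) = 3 := by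
  have hcard := IntermediateField.card_algHom_adjoin_integral ℚ (K := ℝ) (isIntegral_of_root h)
    (minpoly.irreducible (isIntegral_of_root h)).separable
  rw [Nat.card_congr (RingHom.equivRatAlgHom ℚ⟮θ⟯ ℝ)]
  rw [minpoly_eq_unitCubic h hn, natDegree_unitCubic] at hcard
  refine hcard ?_
  have : (unitCubic P Q).map (algebraMap ℚ ℝ) = (X - C r₁) * (X - C r₂) * (X - C r₃) := by
    refine Polynomial.funext fun x => ?_
    rw [eval_map_algebraMap, aeval_unitCubic, hr]
    simp
  rw [this]
  exact ((Splits.X_sub_C _).mul (Splits.X_sub_C _)).mul (Splits.X_sub_C _)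

theorem rootGen_cubic {θ : ℝ} {P Q : ℤ} (h : θ ^ 3 + P * θ ^ 2 + Q * θ + 1 = 0) :
    (rootGen θ) ^ 3 + P * (rootGen θ) ^ 2 + Q * (rootGen θ) + 1 = 0 := by
  apply Subtype.ext
  push_cast
  simpa using h

/-- The elements of `ℤ[θ]` are the integral combinations of `1, θ, θ²`. -/
theorem mem_rootOrder_iff {θ : ℝ} {P Q : ℤ} (h : θ ^ 3 + P * θ ^ 2 + Q * θ + 1 = 0)
    {α : ℚ⟮θ⟯} : α ∈ rootOrder θ ↔
      ∃ c : Fin 3 → ℤ, α = c 0 + c 1 * rootGen θ + c 2 * rootGen θ ^ 2 := by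
  have hg := rootGen_cubic h
  constructor
  · intro hα
    induction hα using Algebra.adjoin_induction with
    | mem x hx =>
      rw [Set.mem_singleton_iff] at hx
      exact ⟨![0, 1, 0], by simp [hx]⟩
    | algebraMap n => exact ⟨![n, 0, 0], by simp⟩
    | add x y _ _ hx hy =>
      obtain ⟨c, rfl⟩ := hx
      obtain ⟨d, rfl⟩ := hy
      refine ⟨c + d, ?_⟩
      simp only [Pi.add_apply]
      push_cast
      ring
    | mul x y _ _ hx hy =>
      obtain ⟨c, rfl⟩ := hx
      obtain ⟨d, rfl⟩ := hy
      refine ⟨![c 0 * d 0 - (c 1 * d 2 + c 2 * d 1) + c 2 * d 2 * P,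
        c 0 * d 1 + c 1 * d 0 - (c 1 * d 2 + c 2 * d 1) * Q - c 2 * d 2 * (1 - P * Q),
        c 0 * d 2 + c 1 * d 1 + c 2 * d 0 - (c 1 * d 2 + c 2 * d 1) * P
          + c 2 * d 2 * (P ^ 2 - Q)], ?_⟩
      simp only [Matrix.cons_val_zero, Matrix.cons_val_one, Matrix.cons_val]
      push_cast
      linear_combination ((c 1 : ℚ⟮θ⟯) * d 2 + c 2 * d 1 + c 2 * d 2 * (rootGen θ - P)) * hg
  · rintro ⟨c, rfl⟩
    have hgen : rootGen θ ∈ rootOrder θ := Algebra.subset_adjoin rfl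
    have hint : ∀ n : ℤ, (n : ℚ⟮θ⟯) ∈ rootOrder θ := fun n =>
      (rootOrder θ).intCast_mem n
    exact add_mem (add_mem (hint _) (mul_mem (hint _) hgen)) (mul_mem (hint _) (pow_mem hgen 2))

theorem mem_unitSet_iff {K : Type*} [Field K] {O : Subalgebra ℤ K} {α : K} :
    α ∈ unitSet O ↔ α ∈ O ∧ ∃ β ∈ O, α * β = 1 := by
  constructor
  · rintro ⟨u, rfl⟩
    refine ⟨SetLike.coe_mem _, ((u⁻¹ : Oˣ) : O), SetLike.coe_mem _, ?_⟩
    rw [← MulMemClass.coe_mul, Units.mul_inv]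
    rfl
  · rintro ⟨hα, β, hβ, h⟩
    exact ⟨⟨⟨α, hα⟩, ⟨β, hβ⟩, Subtype.ext h, Subtype.ext ((mul_comm _ _).trans h)⟩, rfl⟩

theorem one_mem_unitSet {K : Type*} [Field K] (O : Subalgebra ℤ K) : (1 : K) ∈ unitSet O :=
  ⟨1, rfl⟩

theorem mul_mem_unitSet {K : Type*} [Field K] {O : Subalgebra ℤ K} {α β : K}
    (hα : α ∈ unitSet O) (hβ : β ∈ unitSet O) : α * β ∈ unitSet O := by
  obtain ⟨u, rfl⟩ := hα
  obtain ⟨v, rfl⟩ := hβ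
  exact ⟨u * v, rfl⟩

theorem inv_mem_unitSet {K : Type*} [Field K] {O : Subalgebra ℤ K} {α : K}
    (hα : α ∈ unitSet O) : α⁻¹ ∈ unitSet O := by
  obtain ⟨hα, β, hβ, h⟩ := mem_unitSet_iff.1 hα
  rw [← eq_inv_of_mul_eq_one_right h]
  exact mem_unitSet_iff.2 ⟨hβ, α, hα, (mul_comm _ _).trans h⟩

theorem ne_zero_of_mem_unitSet {K : Type*} [Field K] {O : Subalgebra ℤ K} {α : K}
    (hα : α ∈ unitSet O) : α ≠ 0 := by
  obtain ⟨-, β, -, h⟩ := mem_unitSet_iff.1 hα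
  exact left_ne_zero_of_mul_eq_one h

theorem zpow_mem_unitSet {K : Type*} [Field K] {O : Subalgebra ℤ K} {α : K}
    (hα : α ∈ unitSet O) (n : ℤ) : α ^ n ∈ unitSet O := by
  obtain ⟨u, rfl⟩ := hα
  have hnat : ∀ k : ℕ, ((u : O) : K) ^ k ∈ unitSet O := fun k => ⟨u ^ k, by simp⟩
  obtain ⟨k, rfl | rfl⟩ := n.eq_nat_or_neg
  · simpa using hnat k
  · simpa using inv_mem_unitSet (hnat k)

section LogEmbedding

variable {K : Type*} [Field K] (σ : Fin 3 → (K →+* ℝ))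

theorem logEmbedding_mul {α β : K} (hα : α ≠ 0) (hβ : β ≠ 0) :
    logEmbedding σ (α * β) = logEmbedding σ α + logEmbedding σ β := by
  ext i
  simp only [logEmbedding, map_mul, abs_mul, PiLp.add_apply]
  exact Real.log_mul (by simpa using hα) (by simpa using hβ)

theorem logEmbedding_inv (α : K) : logEmbedding σ α⁻¹ = -logEmbedding σ α := by
  ext i
  simp [logEmbedding, abs_inv, Real.log_inv]

theorem logEmbedding_one : logEmbedding σ (1 : K) = 0 := by
  ext i
  simp [logEmbedding]

theorem logEmbedding_zpow (α : K) (n : ℤ) :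
    logEmbedding σ (α ^ n) = n • logEmbedding σ α := by
  ext i
  simp [logEmbedding, abs_zpow, Real.log_zpow]

end LogEmbedding

namespace IsCubicDatum

variable {θ : ℝ} {P Q : ℤ} {σ : Fin 3 → (ℚ⟮θ⟯ →+* ℝ)}

theorem conj_root (h : IsCubicDatum θ P Q σ) (i : Fin 3) :
    (σ i (rootGen θ)) ^ 3 + P * (σ i (rootGen θ)) ^ 2 + Q * σ i (rootGen θ) + 1 = 0 := by
  have := congrArg (σ i) (rootGen_cubic h.root)
  simpa using this

theorem conj_injective (h : IsCubicDatum θ P Q σ) :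
    Function.Injective fun i => σ i (rootGen θ) := by
  intro i j hij
  apply h.inj
  have : (σ i).toRatAlgHom = (σ j).toRatAlgHom := by
    refine IntermediateField.algHom_ext_of_eq_adjoin ℚ (s := {θ}) rfl ?_
    rintro x rfl
    exact hij
  ext x
  exact DFunLike.congr_fun this x

theorem vieta (h : IsCubicDatum θ P Q σ) :
    σ 0 (rootGen θ) + σ 1 (rootGen θ) + σ 2 (rootGen θ) = -P ∧
    σ 0 (rootGen θ) * σ 1 (rootGen θ) + σ 0 (rootGen θ) * σ 2 (rootGen θ)
      + σ 1 (rootGen θ) * σ 2 (rootGen θ) = Q ∧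
    σ 0 (rootGen θ) * σ 1 (rootGen θ) * σ 2 (rootGen θ) = -1 := by
  have h0 := h.conj_root 0
  have h1 := h.conj_root 1
  have h2 := h.conj_root 2
  have n01 : σ 0 (rootGen θ) - σ 1 (rootGen θ) ≠ 0 := fun e =>
    absurd (h.conj_injective (sub_eq_zero.1 e)) (by decide)
  have n02 : σ 0 (rootGen θ) - σ 2 (rootGen θ) ≠ 0 := fun e =>
    absurd (h.conj_injective (sub_eq_zero.1 e)) (by decide)
  have n12 : σ 1 (rootGen θ) - σ 2 (rootGen θ) ≠ 0 := fun e =>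
    absurd (h.conj_injective (sub_eq_zero.1 e)) (by decide)
  generalize σ 0 (rootGen θ) = x at *
  generalize σ 1 (rootGen θ) = y at *
  generalize σ 2 (rootGen θ) = z at *
  have a1 : x ^ 2 + x * y + y ^ 2 + P * (x + y) + Q = 0 := by
    apply mul_left_cancel₀ n01
    linear_combination h0 - h1
  have a2 : x ^ 2 + x * z + z ^ 2 + P * (x + z) + Q = 0 := by
    apply mul_left_cancel₀ n02
    linear_combination h0 - h2
  have e1 : x + y + z = -P := by
    have : (y - z) * (x + y + z + P) = 0 := by linear_combination a1 - a2
    rcases mul_eq_zero.1 this with h | h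
    · exact absurd h n12
    · linarith
  have e2 : x * y + x * z + y * z = Q := by linear_combination (x + y) * e1 - a1
  refine ⟨e1, e2, ?_⟩
  linear_combination h0 - x ^ 2 * e1 + x * e2

theorem conj_eq (σ : Fin 3 → (ℚ⟮θ⟯ →+* ℝ)) (c : Fin 3 → ℤ) (i : Fin 3) :
    σ i (c 0 + c 1 * rootGen θ + c 2 * rootGen θ ^ 2) =
      c 0 + c 1 * σ i (rootGen θ) + c 2 * σ i (rootGen θ) ^ 2 := by
  simp

/-- The norm of an element of `ℤ[θ]` is an integer. -/
theorem exists_int_norm (h : IsCubicDatum θ P Q σ) {α : ℚ⟮θ⟯} (hα : α ∈ rootOrder θ) :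
    ∃ n : ℤ, σ 0 α * σ 1 α * σ 2 α = n := by
  obtain ⟨c, rfl⟩ := (mem_rootOrder_iff h.root).1 hα
  obtain ⟨e1, e2, e3⟩ := h.vieta
  simp only [conj_eq]
  generalize σ 0 (rootGen θ) = x at *
  generalize σ 1 (rootGen θ) = y at *
  generalize σ 2 (rootGen θ) = z at *
  -- The expanded product is symmetric in the conjugates; this is its expression through the
  -- elementary symmetric functions `-P, Q, -1`.
  refine ⟨c 0 ^ 3 - c 0 ^ 2 * c 1 * P + c 0 ^ 2 * c 2 * (P ^ 2 - 2 * Q) + c 0 * c 1 ^ 2 * Q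
    + c 0 * c 1 * c 2 * (3 - P * Q) + c 0 * c 2 ^ 2 * (Q ^ 2 - 2 * P) - c 1 ^ 3
    + c 1 ^ 2 * c 2 * P - c 1 * c 2 ^ 2 * Q + c 2 ^ 3, ?_⟩
  have hP : (P : ℝ) = -(x + y + z) := by linarith
  have hone : (1 : ℝ) = -(x * y * z) := by linarith
  have h3 : (3 : ℝ) = -(3 * (x * y * z)) := by linarith
  push_cast
  rw [← e2, hP]
  linear_combination (-(c 0 * c 1 * c 2 * 3) - c 0 * c 2 ^ 2 * (2 * (x + y + z)) + c 1 ^ 3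
    + c 1 ^ 2 * c 2 * (x + y + z) + c 1 * c 2 ^ 2 * (x * y + x * z + y * z)
    + c 2 ^ 3 * (x * y * z - 1) : ℝ) * e3

theorem abs_norm_unit (h : IsCubicDatum θ P Q σ) {α : ℚ⟮θ⟯} (hα : α ∈ unitSet (rootOrder θ)) :
    |σ 0 α| * |σ 1 α| * |σ 2 α| = 1 := by
  obtain ⟨hα, β, hβ, hm⟩ := mem_unitSet_iff.1 hα
  obtain ⟨n, hn⟩ := h.exists_int_norm hα
  obtain ⟨k, hk⟩ := h.exists_int_norm hβ
  have hs : ∀ i, σ i α * σ i β = 1 := fun i => by rw [← map_mul, hm, map_one]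
  have hnk : n * k = 1 := by
    have : (n : ℝ) * k = 1 := by
      rw [← hn, ← hk]
      calc _ = (σ 0 α * σ 0 β) * (σ 1 α * σ 1 β) * (σ 2 α * σ 2 β) := by ring
        _ = 1 := by rw [hs, hs, hs]; norm_num
    exact_mod_cast this
  rw [← abs_mul, ← abs_mul, hn]
  rcases Int.isUnit_iff.1 (IsUnit.of_mul_eq_one k hnk) with rfl | rfl <;> simp

theorem sum_logEmbedding (h : IsCubicDatum θ P Q σ) {α : ℚ⟮θ⟯}
    (hα : α ∈ unitSet (rootOrder θ)) : ∑ i, logEmbedding σ α i = 0 := by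
  have hne : ∀ i, |σ i α| ≠ 0 := fun i => by
    simpa using ne_zero_of_mem_unitSet hα
  rw [Fin.sum_univ_three]
  simp only [logEmbedding]
  rw [← Real.log_mul (hne 0) (hne 1), ← Real.log_mul (mul_ne_zero (hne 0) (hne 1)) (hne 2),
    h.abs_norm_unit hα, Real.log_one]

/-- The Vandermonde determinant of the conjugates. -/
def _root_.conjVandermonde {K : Type*} [Field K] (σ : Fin 3 → (K →+* ℝ)) (α : K) : ℝ :=
  (σ 1 α - σ 0 α) * (σ 2 α - σ 0 α) * (σ 2 α - σ 1 α)

theorem conjVandermonde_ne_zero (h : IsCubicDatum θ P Q σ) :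
    conjVandermonde σ (rootGen θ) ≠ 0 := by
  have n01 : σ 1 (rootGen θ) - σ 0 (rootGen θ) ≠ 0 := fun e =>
    absurd (h.conj_injective (sub_eq_zero.1 e)) (by decide)
  have n02 : σ 2 (rootGen θ) - σ 0 (rootGen θ) ≠ 0 := fun e =>
    absurd (h.conj_injective (sub_eq_zero.1 e)) (by decide)
  have n12 : σ 2 (rootGen θ) - σ 1 (rootGen θ) ≠ 0 := fun e =>
    absurd (h.conj_injective (sub_eq_zero.1 e)) (by decide)
  exact mul_ne_zero (mul_ne_zero n01 n02) n12

theorem conj_ne_rat (h : IsCubicDatum θ P Q σ) (i : Fin 3) (q : ℚ) : σ i (rootGen θ) ≠ q := by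
  intro e
  have := h.conj_root i
  rw [e] at this
  exact h.no_rat q (by exact_mod_cast this)

/-- A unit of `ℤ[θ]` is `±1`, or its conjugates are at least as far apart as those of `θ`. -/
theorem unit_vandermonde (h : IsCubicDatum θ P Q σ) {α : ℚ⟮θ⟯}
    (hα : α ∈ unitSet (rootOrder θ)) :
    logEmbedding σ α = 0 ∨ |conjVandermonde σ (rootGen θ)| ≤ |conjVandermonde σ α| := by
  obtain ⟨c, hc⟩ := (mem_rootOrder_iff h.root).1 (mem_unitSet_iff.1 hα).1
  by_cases hrat : c 1 = 0 ∧ c 2 = 0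
  · left
    have hαc : α = (c 0 : ℚ⟮θ⟯) := by rw [hc, hrat.1, hrat.2]; simp
    have hn := h.abs_norm_unit hα
    rw [hαc] at hn ⊢
    simp only [map_intCast] at hn
    have hpow : |(c 0 : ℝ)| ^ 3 = 1 := by linear_combination hn
    have h1 : |(c 0 : ℝ)| = 1 := (pow_eq_one_iff_of_nonneg (abs_nonneg _) (by norm_num)).1 hpow
    ext i
    simp [logEmbedding, h1]
  · right
    obtain ⟨e1, e2, e3⟩ := h.vieta
    -- For distinct `i, j, k`, `α_i - α_j = (θ_i - θ_j)(c₁ + c₂(θ_i + θ_j))`, and the last factor is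
    -- `c₁ - c₂ P - c₂ θ_k` since the conjugates sum to `-P`. The quotient of the two Vandermonde
    -- determinants is therefore the norm of `c₁ - c₂ P - c₂ θ`, a nonzero integer.
    have hne : ∀ i, ((c 1 : ℝ) - c 2 * P) - c 2 * σ i (rootGen θ) ≠ 0 := by
      intro i e
      by_cases h2 : c 2 = 0
      · rw [h2] at e
        simp only [Int.cast_zero, zero_mul, sub_zero, Int.cast_eq_zero] at e
        exact hrat ⟨e, h2⟩
      · have h2' : (c 2 : ℝ) ≠ 0 := by exact_mod_cast h2
        apply h.conj_ne_rat i (((c 1 : ℚ) - c 2 * P) / c 2)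
        push_cast
        rw [eq_div_iff h2']
        linear_combination -e
    have h0 := hne 0
    have h1 := hne 1
    have h2 := hne 2
    rw [hc]
    simp only [conjVandermonde, conj_eq]
    generalize σ 0 (rootGen θ) = x at *
    generalize σ 1 (rootGen θ) = y at *
    generalize σ 2 (rootGen θ) = z at *
    have hP : (P : ℝ) = -(x + y + z) := by linarith
    obtain ⟨n, hn⟩ : ∃ n : ℤ, (((c 1 : ℝ) - c 2 * P) - c 2 * x) * (((c 1 : ℝ) - c 2 * P) - c 2 * y)
        * (((c 1 : ℝ) - c 2 * P) - c 2 * z) = n := by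
      refine ⟨(c 1 - c 2 * P) ^ 3 + (c 1 - c 2 * P) ^ 2 * c 2 * P + (c 1 - c 2 * P) * c 2 ^ 2 * Q
        + c 2 ^ 3, ?_⟩
      push_cast
      rw [← e2]
      linear_combination (-(c 1 - c 2 * P : ℝ) ^ 2 * c 2) * e1 - (c 2 : ℝ) ^ 3 * e3
    have hn0 : (n : ℝ) ≠ 0 := by
      rw [← hn]
      exact mul_ne_zero (mul_ne_zero h0 h1) h2
    have hn1 : (1 : ℝ) ≤ |(n : ℝ)| := by
      have : n ≠ 0 := by exact_mod_cast hn0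
      exact_mod_cast Int.one_le_abs this
    have key : (c 0 + c 1 * y + c 2 * y ^ 2 - (c 0 + c 1 * x + c 2 * x ^ 2)) *
        (c 0 + c 1 * z + c 2 * z ^ 2 - (c 0 + c 1 * x + c 2 * x ^ 2)) *
        (c 0 + c 1 * z + c 2 * z ^ 2 - (c 0 + c 1 * y + c 2 * y ^ 2)) =
        (n : ℝ) * ((y - x) * (z - x) * (z - y)) := by
      rw [← hn, hP]
      ring
    rw [key, abs_mul (n : ℝ)]
    exact le_mul_of_one_le_left (abs_nonneg _) hn1

/-- If the logarithms of the conjugates are close together, then so are the conjugates. -/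
theorem abs_conjVandermonde_lt {K : Type*} [Field K] {σ : Fin 3 → (K →+* ℝ)} {α : K} {m : ℝ}
    (h0 : α ≠ 0) (hsum : ∑ i, logEmbedding σ α i = 0)
    (h02 : |logEmbedding σ α 0 - logEmbedding σ α 2| < m)
    (h12 : |logEmbedding σ α 1 - logEmbedding σ α 2| < m)
    (h01 : |logEmbedding σ α 0 - logEmbedding σ α 1| < m) :
    |conjVandermonde σ α| < 8 * Real.exp m := by
  rw [Fin.sum_univ_three] at hsum
  have hexp : ∀ i, |σ i α| = Real.exp (logEmbedding σ α i) := fun i => by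
    simp only [logEmbedding]
    rw [Real.exp_log (by simpa using h0)]
  have hle : ∀ i j, |σ i α - σ j α| ≤
      2 * Real.exp (max (logEmbedding σ α i) (logEmbedding σ α j)) := by
    intro i j
    calc |σ i α - σ j α| ≤ |σ i α| + |σ j α| := abs_sub _ _
      _ ≤ _ := by
        rw [hexp, hexp, two_mul]
        exact add_le_add (Real.exp_le_exp.2 (le_max_left _ _)) (Real.exp_le_exp.2 (le_max_right _ _))
  rw [conjVandermonde, abs_mul, abs_mul]
  generalize hx : logEmbedding σ α 0 = x at *
  generalize hy : logEmbedding σ α 1 = y at *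
  generalize hz : logEmbedding σ α 2 = z at *
  have b1 := hle 1 0
  have b2 := hle 2 0
  have b3 := hle 2 1
  rw [hx, hy] at b1
  rw [hx, hz] at b2
  rw [hy, hz] at b3
  -- The largest coordinate is counted twice and the middle one once; as the sum is zero, this
  -- equals largest minus smallest.
  have hmax : max y x + max z x + max z y < m := by
    rw [abs_lt] at h01 h02 h12
    rcases le_total y x with h | h <;> rcases le_total z x with h' | h' <;>
      rcases le_total z y with h'' | h'' <;> simp only [h, h', h'', max_eq_left, max_eq_right] <;>
      linarith
  calc |σ 1 α - σ 0 α| * |σ 2 α - σ 0 α| * |σ 2 α - σ 1 α|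
      ≤ (2 * Real.exp (max y x)) * (2 * Real.exp (max z x)) * (2 * Real.exp (max z y)) := by
        gcongr
    _ = 8 * Real.exp (max y x + max z x + max z y) := by
        rw [Real.exp_add, Real.exp_add]
        ring
    _ < 8 * Real.exp m := by
        have := Real.exp_lt_exp.2 hmax
        linarith

end IsCubicDatum

/-! ### The unimodular lattice of a cubic order -/

/-- Coordinatewise multiplication. -/
def scaleMap (d : Fin 3 → ℝ) : E3 →ₗ[ℤ] E3 where
  toFun v := WithLp.toLp 2 fun i => d i * v i
  map_add' v w := by ext i; simp [mul_add]
  map_smul' n v := by ext i; simp; ring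

theorem scaleMap_apply (d : Fin 3 → ℝ) (v : E3) (i : Fin 3) : scaleMap d v i = d i * v i := rfl

theorem columnLattice_diagExp_mul {y : E3} (hy : ∑ j, y j = 0) (g : SL3R) :
    columnLattice (diagExp y * g) = (columnLattice g).map (scaleMap fun i => Real.exp (y i)) := by
  rw [columnLattice, columnLattice, Submodule.map_span, ← Set.range_comp]
  congr 2
  ext j i
  simp only [Function.comp, scaleMap_apply]
  rw [Matrix.SpecialLinearGroup.coe_mul, diagExp_apply hy, Matrix.diagonal_mul]

namespace IsCubicDatum

variable {θ : ℝ} {P Q : ℤ} {σ : Fin 3 → (ℚ⟮θ⟯ →+* ℝ)}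

theorem orderLattice_eq_span (h : IsCubicDatum θ P Q σ) :
    orderLattice σ (rootOrder θ) =
      Submodule.span ℤ (Set.range fun j : Fin 3 => realEmbedding σ (rootGen θ ^ (j : ℕ))) := by
  ext v
  rw [Submodule.mem_span_range_iff_exists_fun]
  constructor
  · rintro ⟨α, hα, rfl⟩
    obtain ⟨c, rfl⟩ := (mem_rootOrder_iff h.root).1 hα
    refine ⟨c, ?_⟩
    rw [Fin.sum_univ_three, ← map_smul, ← map_smul, ← map_smul, ← map_add, ← map_add]
    congr 1
    simp
  · rintro ⟨c, rfl⟩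
    refine ⟨c 0 + c 1 * rootGen θ + c 2 * rootGen θ ^ 2, (mem_rootOrder_iff h.root).2 ⟨c, rfl⟩, ?_⟩
    rw [Fin.sum_univ_three, ← map_smul, ← map_smul, ← map_smul, ← map_add, ← map_add]
    congr 1
    simp

theorem det_conj (σ : Fin 3 → (ℚ⟮θ⟯ →+* ℝ)) :
    (Matrix.of fun i j : Fin 3 => σ i (rootGen θ) ^ (j : ℕ)).det =
      conjVandermonde σ (rootGen θ) := by
  rw [Matrix.det_fin_three]
  simp [conjVandermonde]
  ring

theorem covolume_orderLattice (h : IsCubicDatum θ P Q σ) :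
    ZLattice.covolume (orderLattice σ (rootOrder θ)) =
      |conjVandermonde σ (rootGen θ)| := by
  let w : Fin 3 → E3 := fun j => realEmbedding σ (rootGen θ ^ (j : ℕ))
  let e := (EuclideanSpace.basisFun (Fin 3) ℝ).toBasis
  have hmat : e.toMatrix w = Matrix.of fun i j : Fin 3 => σ i (rootGen θ) ^ (j : ℕ) := by
    ext i j
    simp [e, w, Module.Basis.toMatrix_apply, realEmbedding]
  have hdet : e.det w = conjVandermonde σ (rootGen θ) := by
    rw [Module.Basis.det_apply, hmat, det_conj]
  have hb := (Module.Basis.is_basis_iff_det e (v := w)).2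
    (by rw [hdet]; exact h.conjVandermonde_ne_zero.isUnit)
  let bR : Module.Basis (Fin 3) ℝ E3 := Module.Basis.mk hb.1 hb.2.ge
  have hbR : ⇑bR = w := Module.Basis.coe_mk _ _
  have hL : orderLattice σ (rootOrder θ) = Submodule.span ℤ (Set.range bR) := by
    rw [h.orderLattice_eq_span, hbR]
  rw [hL]
  let bZ : Module.Basis (Fin 3) ℤ (Submodule.span ℤ (Set.range bR)) := bR.restrictScalars ℤ
  rw [ZLattice.covolume_eq_det_mul_measureReal _ volume bZ e]
  have h1 : ((↑) : Submodule.span ℤ (Set.range bR) → E3) ∘ bZ = w := by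
    rw [← hbR]
    ext i : 1
    exact bR.restrictScalars_apply ℤ i
  rw [h1, hdet]
  have h2 : volume.real (ZSpan.fundamentalDomain e) = 1 := by
    rw [measureReal_def, measure_congr (ZSpan.fundamentalDomain_ae_parallelepiped e volume)]
    have : parallelepiped e = parallelepiped (EuclideanSpace.basisFun (Fin 3) ℝ) := by
      simp [e]
    rw [this, OrthonormalBasis.volume_parallelepiped]
    simp
  rw [h2, mul_one]

/-- The scaling factor `D ^ (-1/6)`. -/
def _root_.latticeScale {K : Type*} [Field K] (σ : Fin 3 → (K →+* ℝ)) (O : Subalgebra ℤ K) : ℝ :=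
  orderDisc σ O ^ (-(1 / 6) : ℝ)

theorem latticeScale_eq_exp (h : IsCubicDatum θ P Q σ) : latticeScale σ (rootOrder θ) =
    Real.exp (-(1 / 3) * Real.log |conjVandermonde σ (rootGen θ)|) := by
  have hV := abs_pos.2 h.conjVandermonde_ne_zero
  rw [latticeScale, orderDisc, h.covolume_orderLattice, Real.rpow_def_of_pos (by positivity),
    Real.log_pow]
  congr 1
  push_cast
  ring

theorem latticeScale_pos (h : IsCubicDatum θ P Q σ) : 0 < latticeScale σ (rootOrder θ) := by
  rw [h.latticeScale_eq_exp]
  exact Real.exp_pos _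

theorem latticeScale_cube (h : IsCubicDatum θ P Q σ) :
    latticeScale σ (rootOrder θ) ^ 3 * |conjVandermonde σ (rootGen θ)| = 1 := by
  have hV := abs_pos.2 h.conjVandermonde_ne_zero
  rw [h.latticeScale_eq_exp, ← Real.exp_nat_mul]
  calc Real.exp (((3 : ℕ) : ℝ) * (-(1 / 3) * Real.log |conjVandermonde σ (rootGen θ)|)) *
        |conjVandermonde σ (rootGen θ)|
      = Real.exp (((3 : ℕ) : ℝ) * (-(1 / 3) * Real.log |conjVandermonde σ (rootGen θ)|)) *
        Real.exp (Real.log |conjVandermonde σ (rootGen θ)|) := by rw [Real.exp_log hV]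
    _ = 1 := by
        rw [← Real.exp_add, Real.exp_eq_one_iff]
        push_cast
        ring

theorem mem_unimodularLattice {v : E3} :
    v ∈ unimodularLattice σ (rootOrder θ) ↔
      ∃ α ∈ rootOrder θ, v = latticeScale σ (rootOrder θ) • realEmbedding σ α := by
  constructor
  · rintro ⟨_, ⟨α, hα, rfl⟩, rfl⟩
    exact ⟨α, hα, rfl⟩
  · rintro ⟨α, hα, rfl⟩
    exact ⟨_, ⟨α, hα, rfl⟩, rfl⟩

/-- The scaled embeddings of `1, θ, θ²` form a matrix of determinant `±1`; changing the sign of one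
column makes it `1` without changing the lattice. -/
theorem exists_columnLattice_eq (h : IsCubicDatum θ P Q σ) :
    ∃ g : SL3R, columnLattice g = unimodularLattice σ (rootOrder θ) := by
  set s := latticeScale σ (rootOrder θ) with hs
  set V := conjVandermonde σ (rootGen θ) with hV
  have hcube : s ^ 3 * |V| = 1 := h.latticeScale_cube
  obtain ⟨ε, hε, hεV⟩ : ∃ ε : ℤ, (ε = 1 ∨ ε = -1) ∧ (ε : ℝ) * V = |V| := by
    rcases le_total 0 V with h0 | h0
    · exact ⟨1, Or.inl rfl, by simp [abs_of_nonneg h0]⟩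
    · exact ⟨-1, Or.inr rfl, by simp [abs_of_nonpos h0]⟩
  have hεε : ε * ε = 1 := by rcases hε with rfl | rfl <;> norm_num
  obtain ⟨d, hdd, hdε⟩ : ∃ d : Fin 3 → ℤ, (∀ j, d j * d j = 1) ∧ d 0 * d 1 * d 2 = ε := by
    refine ⟨![ε, 1, 1], fun j => ?_, by simp⟩
    fin_cases j <;> simp [hεε]
  have hdε' : (d 0 : ℝ) * d 1 * d 2 = ε := by exact_mod_cast hdε
  obtain ⟨G, hG, hcol⟩ : ∃ G : Matrix (Fin 3) (Fin 3) ℝ, G.det = 1 ∧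
      ∀ j, (WithLp.toLp 2 fun i : Fin 3 => G i j : E3) =
        d j • s • realEmbedding σ (rootGen θ ^ (j : ℕ)) := by
    refine ⟨s • ((Matrix.of fun i j : Fin 3 => σ i (rootGen θ) ^ (j : ℕ)) *
      Matrix.diagonal fun j => (d j : ℝ)), ?_, ?_⟩
    · rw [Matrix.det_smul, Matrix.det_mul, det_conj, Matrix.det_diagonal, Fin.prod_univ_three,
        hdε', ← hcube, ← hεV, Fintype.card_fin]
      ring
    · intro j
      ext i
      simp [Matrix.mul_diagonal, realEmbedding]
      ring
  refine ⟨⟨G, hG⟩, ?_⟩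
  have hmem : ∀ j, (WithLp.toLp 2 fun i : Fin 3 => G i j : E3) ∈ columnLattice ⟨G, hG⟩ :=
    fun j => Submodule.subset_span ⟨j, rfl⟩
  have hmemL : ∀ j, (WithLp.toLp 2 fun i : Fin 3 => G i j : E3) ∈
      unimodularLattice σ (rootOrder θ) := by
    intro j
    have hpow : rootGen θ ^ (j : ℕ) ∈ rootOrder θ :=
      pow_mem (Algebra.subset_adjoin (Set.mem_singleton _)) _
    have hs' : s • realEmbedding σ (rootGen θ ^ (j : ℕ)) ∈ unimodularLattice σ (rootOrder θ) :=
      mem_unimodularLattice.2 ⟨_, hpow, hs ▸ rfl⟩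
    rw [hcol]
    exact Submodule.smul_mem _ (d j) hs'
  apply le_antisymm
  · refine Submodule.span_le.2 ?_
    rintro _ ⟨j, rfl⟩
    exact hmemL j
  · intro v hv
    obtain ⟨α, hα, rfl⟩ := mem_unimodularLattice.1 hv
    have hφ : realEmbedding σ α ∈ orderLattice σ (rootOrder θ) := ⟨α, hα, rfl⟩
    rw [h.orderLattice_eq_span] at hφ
    obtain ⟨c, hc⟩ := (Submodule.mem_span_range_iff_exists_fun ℤ).1 hφ
    rw [← hc, Finset.smul_sum]
    refine Submodule.sum_mem _ fun j _ => ?_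
    rw [smul_comm]
    refine Submodule.smul_mem _ _ ?_
    have := Submodule.smul_mem _ (d j) (hmem j)
    rw [hcol, smul_smul, hdd, one_smul] at this
    exact this

/-- The factor `2` turns `|σ i α|` into `σ i (α ^ 2)`. A positive diagonal matrix with entries `|σ i
α|` need not preserve the lattice when the signs of the conjugates differ. -/
theorem scaleMap_embedding (σ : Fin 3 → (ℚ⟮θ⟯ →+* ℝ)) (s : ℝ) {α : ℚ⟮θ⟯} (hα : α ≠ 0)
    (β : ℚ⟮θ⟯) :
    scaleMap (fun i => Real.exp (((2 : ℝ) • logEmbedding σ α) i)) (s • realEmbedding σ β) =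
      s • realEmbedding σ (α ^ 2 * β) := by
  ext i
  have hne : 0 < |σ i α| := by simpa using hα
  have : Real.exp (((2 : ℝ) • logEmbedding σ α) i) = σ i α ^ 2 := by
    simp only [logEmbedding, PiLp.smul_apply, smul_eq_mul]
    rw [show (2 : ℝ) = ((2 : ℕ) : ℝ) by norm_num, ← Real.log_pow, Real.exp_log (by positivity),
      sq_abs]
  rw [scaleMap_apply, this]
  simp [realEmbedding]
  ring

/-- Squares of units are periods of the orbit. -/
theorem diagExp_smul_pointOf (h : IsCubicDatum θ P Q σ) {α : ℚ⟮θ⟯}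
    (hα : α ∈ unitSet (rootOrder θ)) :
    diagExp ((2 : ℝ) • logEmbedding σ α) • pointOf (unimodularLattice σ (rootOrder θ)) =
      pointOf (unimodularLattice σ (rootOrder θ)) := by
  obtain ⟨g, hg⟩ := h.exists_columnLattice_eq
  have hsum : ∀ α ∈ unitSet (rootOrder θ), ∑ j, ((2 : ℝ) • logEmbedding σ α) j = 0 := by
    intro α hα
    simp only [PiLp.smul_apply, ← Finset.smul_sum, h.sum_logEmbedding hα, smul_zero]
  have hmap : ∀ α ∈ unitSet (rootOrder θ), ∀ v ∈ unimodularLattice σ (rootOrder θ),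
      scaleMap (fun i => Real.exp (((2 : ℝ) • logEmbedding σ α) i)) v ∈
        unimodularLattice σ (rootOrder θ) := by
    intro α hα v hv
    obtain ⟨β, hβ, rfl⟩ := mem_unimodularLattice.1 hv
    rw [scaleMap_embedding σ _ (ne_zero_of_mem_unitSet hα)]
    exact mem_unimodularLattice.2
      ⟨_, mul_mem (pow_mem (mem_unitSet_iff.1 hα).1 2) hβ, rfl⟩
  rw [← hg, pointOf_columnLattice]
  change ((diagExp _ * g : SL3R) : LatticeSpace) = _
  apply mk_eq_of_columnLattice_eq
  rw [columnLattice_diagExp_mul (hsum α hα), hg]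
  apply le_antisymm
  · rintro _ ⟨v, hv, rfl⟩
    exact hmap α hα v hv
  · intro v hv
    refine ⟨_, hmap _ (inv_mem_unitSet hα) v hv, ?_⟩
    obtain ⟨β, hβ, rfl⟩ := mem_unimodularLattice.1 hv
    have h0 := ne_zero_of_mem_unitSet hα
    rw [scaleMap_embedding σ _ (inv_ne_zero h0), scaleMap_embedding σ _ h0]
    congr 2
    field_simp

theorem norm_le_of_forall_abs_le {v : E3} {c : ℝ} (hc : 0 ≤ c) (h : ∀ i, |v i| ≤ c) :
    ‖v‖ ≤ 2 * c := by
  rw [EuclideanSpace.norm_eq, Fin.sum_univ_three]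
  apply Real.sqrt_le_iff.2
  refine ⟨by positivity, ?_⟩
  have hs : ∀ i, ‖v i‖ ^ 2 ≤ c ^ 2 := fun i => by
    rw [Real.norm_eq_abs]
    exact pow_le_pow_left₀ (abs_nonneg _) (h i) 2
  nlinarith [hs 0, hs 1, hs 2]

/-- A lattice of the orbit has a short vector if the translate of its parameter by a unit has
small coordinates. -/
theorem notMem_of_unit (h : IsCubicDatum θ P Q σ) {K : Set LatticeSpace} {ε : ℝ}
    (hK : ∀ g : SL3R, (g : LatticeSpace) ∈ K → ∀ v ∈ columnLattice g, v ≠ 0 → ε ≤ ‖v‖)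
    {y : E3} (hy : ∑ j, y j = 0) {α : ℚ⟮θ⟯} (hα : α ∈ unitSet (rootOrder θ)) {c : ℝ}
    (hc : ∀ i, y i + logEmbedding σ α i ≤ c)
    (hcε : 2 * Real.exp (c - 1 / 3 * Real.log |conjVandermonde σ (rootGen θ)|) < ε) :
    diagExp y • pointOf (unimodularLattice σ (rootOrder θ)) ∉ K := by
  obtain ⟨g, hg⟩ := h.exists_columnLattice_eq
  rw [← hg, pointOf_columnLattice]
  intro hmem
  have hmem' : ((diagExp y * g : SL3R) : LatticeSpace) ∈ K := hmem
  have h0 := ne_zero_of_mem_unitSet hα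
  set s := latticeScale σ (rootOrder θ) with hs
  have hspos : 0 < s := h.latticeScale_pos
  set v : E3 := scaleMap (fun i => Real.exp (y i)) (s • realEmbedding σ α) with hv
  have hvi : ∀ i, |v i| = Real.exp (y i + logEmbedding σ α i) * s := by
    intro i
    have hne : 0 < |σ i α| := by simpa using h0
    rw [hv, scaleMap_apply, abs_mul, abs_of_pos (Real.exp_pos _), Real.exp_add]
    simp only [logEmbedding, Real.exp_log hne]
    simp [realEmbedding, abs_mul, abs_of_pos hspos]
    ring
  have hvL : v ∈ columnLattice (diagExp y * g) := by
    rw [columnLattice_diagExp_mul hy, hg]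
    exact ⟨_, mem_unimodularLattice.2 ⟨α, (mem_unitSet_iff.1 hα).1, rfl⟩, rfl⟩
  have hv0 : v ≠ 0 := by
    intro e
    have h1 := hvi 0
    rw [e] at h1
    have : 0 < Real.exp (y 0 + logEmbedding σ α 0) * s := by positivity
    simp at h1
    linarith
  have h1 := hK _ hmem' v hvL hv0
  have h2 : ‖v‖ ≤ 2 * Real.exp (c - 1 / 3 * Real.log |conjVandermonde σ (rootGen θ)|) := by
    apply norm_le_of_forall_abs_le (Real.exp_pos _).le
    intro i
    rw [hvi, hs, h.latticeScale_eq_exp, ← Real.exp_add]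
    apply Real.exp_le_exp.2
    linarith [hc i]
  linarith

/-- The height of the lattice is at least of the order of `D ^ (1/6)`. -/
theorem le_latticeHeight (h : IsCubicDatum θ P Q σ) :
    Real.exp (1 / 3 * Real.log |conjVandermonde σ (rootGen θ)|) / 2 ≤
      latticeHeight (unimodularLattice σ (rootOrder θ)) := by
  obtain ⟨g, hg⟩ := h.exists_columnLattice_eq
  set s := latticeScale σ (rootOrder θ) with hs
  have hspos : 0 < s := h.latticeScale_pos
  set v : E3 := s • realEmbedding σ 1 with hv
  have hvi : ∀ i, v i = s := by
    intro i
    simp [hv, realEmbedding]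
  have hv0 : v ≠ 0 := by
    intro e
    have h1 := hvi 0
    rw [e] at h1
    simp at h1
    linarith
  have hvL : v ∈ columnLattice g := by
    rw [hg]
    exact mem_unimodularLattice.2 ⟨1, one_mem _, rfl⟩
  have h1 := inv_norm_le_latticeHeight hvL hv0
  rw [hg] at h1
  refine le_trans ?_ h1
  have h2 : ‖v‖ ≤ 2 * s := norm_le_of_forall_abs_le hspos.le fun i => by
    rw [hvi, abs_of_pos hspos]
  have h3 : Real.exp (1 / 3 * Real.log |conjVandermonde σ (rootGen θ)|) = s⁻¹ := by
    rw [hs, h.latticeScale_eq_exp, ← Real.exp_neg]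
    congr 1
    ring
  rw [h3, div_eq_mul_inv, ← mul_inv]
  apply inv_anti₀ (norm_pos_iff.2 hv0)
  linarith

end IsCubicDatum

/-! ### The size of the roots -/

theorem exists_root_cubic_near_one {p q s : ℝ} (hp : |p - 1| ≤ 1 / 32) (hq : |q| ≤ 1 / 32)
    (hs : |s| ≤ 1 / 32) : ∃ k ∈ Set.Icc (1 / 2 : ℝ) 2, k ^ 3 - p * k ^ 2 + q * k + s = 0 := by
  rw [abs_le] at hp hq hs
  have hc : ContinuousOn (fun k : ℝ => k ^ 3 - p * k ^ 2 + q * k + s) (Set.Icc (1 / 2) 2) := by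
    fun_prop
  refine intermediate_value_Icc (by norm_num) hc ⟨?_, ?_⟩ <;> norm_num <;> linarith

theorem exists_root_reverse_cubic_near_one {p q s : ℝ} (hp : |p - 1| ≤ 1 / 32)
    (hq : |q| ≤ 1 / 32) (hs : |s| ≤ 1 / 32) :
    ∃ k ∈ Set.Icc (1 / 2 : ℝ) 2, s * k ^ 3 + q * k ^ 2 - p * k + 1 = 0 := by
  rw [abs_le] at hp hq hs
  have hc : ContinuousOn (fun k : ℝ => s * k ^ 3 + q * k ^ 2 - p * k + 1) (Set.Icc (1 / 2) 2) := by
    fun_prop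
  refine intermediate_value_Icc' (by norm_num) hc ⟨?_, ?_⟩ <;> norm_num <;> linarith

/-- The coefficients `P, Q` belong to the pair `(a, b)` and the parameter `t`, and `t` is large in
comparison with `a³` and `b`. -/
structure IsLargeParameter (a b t c P Q : ℤ) : Prop where
  a_pos : 0 < |a|
  a_lt_b : |a| < |b|
  bc : b * c = a ^ 3 - 1
  hP : a * (P - t * a) = c ^ 2 - b
  hQ : Q = -(a * c) - t * b
  ha : 1000 * |a| ^ 3 ≤ |t|
  hb : 1000 * |b| ≤ |t|

namespace IsLargeParameter

variable {a b t c P Q : ℤ}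

/-- Since `|b| ≥ |a| + 1`, `|c|` is at most `(|a|³ + 1) / (|a| + 1) = |a|² - |a| + 1`. -/
theorem abs_c_le (h : IsLargeParameter a b t c P Q) : |c| ≤ |a| ^ 2 := by
  have h1 : |b| * |c| ≤ |a| ^ 3 + 1 := by
    rw [← abs_mul, h.bc, ← abs_pow]
    exact (abs_sub _ _).trans (by simp)
  have h2 : (|a| + 1) * |c| ≤ |b| * |c| :=
    mul_le_mul_of_nonneg_right h.a_lt_b (abs_nonneg c)
  have h3 := h.a_pos
  have h4 : (|a| + 1) * |c| ≤ (|a| + 1) * (|a| ^ 2 - |a| + 1) := by nlinarith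
  have h5 := le_of_mul_le_mul_left h4 (by linarith)
  linarith

theorem abs_P_sub_le (h : IsLargeParameter a b t c P Q) : |P - t * a| ≤ |a| ^ 3 + |b| := by
  have h3 := h.a_pos
  have hc := h.abs_c_le
  have h1 : |a| * |P - t * a| ≤ |a| ^ 4 + |b| := by
    rw [← abs_mul, h.hP]
    refine (abs_sub _ _).trans ?_
    rw [abs_pow]
    have : |c| ^ 2 ≤ (|a| ^ 2) ^ 2 := pow_le_pow_left₀ (abs_nonneg c) hc 2
    nlinarith
  have h2 : |a| * |P - t * a| ≤ |a| * (|a| ^ 3 + |b|) := by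
    nlinarith [abs_nonneg b]
  exact le_of_mul_le_mul_left h2 h3

theorem abs_Q_add_le (h : IsLargeParameter a b t c P Q) : |Q + t * b| ≤ |a| ^ 3 := by
  have hc := h.abs_c_le
  have : Q + t * b = -(a * c) := by rw [h.hQ]; ring
  rw [this, abs_neg, abs_mul]
  nlinarith [h.a_pos]

/-- The values at `±1` are dominated by `t (a - b)` and `t (a + b)`, which are at least `|t|` in
size because `|a| ≠ |b|`. -/
theorem no_rational_root (h : IsLargeParameter a b t c P Q) (x : ℚ) :
    x ^ 3 + P * x ^ 2 + Q * x + 1 ≠ 0 := by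
  have hP := abs_le.1 h.abs_P_sub_le
  have hQ := abs_le.1 h.abs_Q_add_le
  have ha := h.ha
  have hb := h.hb
  have hb1 : 2 ≤ |b| := by linarith [h.a_lt_b, h.a_pos, Int.add_one_le_of_lt h.a_lt_b]
  have ht : ∀ k : ℤ, k ≠ 0 → |t| ≤ |t * k| := by
    intro k hk
    rw [abs_mul]
    exact le_mul_of_one_le_right (abs_nonneg _) (Int.one_le_abs hk)
  have hne1 : a - b ≠ 0 := by
    intro e
    rw [sub_eq_zero.1 e] at h
    exact lt_irrefl _ h.a_lt_b
  have hne2 : a + b ≠ 0 := by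
    intro e
    have := h.a_lt_b
    rw [eq_neg_of_add_eq_zero_left e, abs_neg] at this
    exact lt_irrefl _ this
  apply unitCubic_no_rational_root
  · intro e
    have h1 := ht _ hne1
    have h2 : t * (a - b) = -((P - t * a) + (Q + t * b) + 2) := by linear_combination e
    rw [h2, abs_neg] at h1
    have : |P - t * a + (Q + t * b) + 2| ≤ |a| ^ 3 + |b| + |a| ^ 3 + 2 := by
      rw [abs_le]
      constructor <;> linarith [hP.1, hP.2, hQ.1, hQ.2]
    linarith
  · intro e
    have h1 := ht _ hne2
    have h2 : t * (a + b) = (Q + t * b) - (P - t * a) := by linear_combination e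
    rw [h2] at h1
    have : |(Q + t * b) - (P - t * a)| ≤ |a| ^ 3 + |b| + |a| ^ 3 := by
      rw [abs_le]
      constructor <;> linarith [hP.1, hP.2, hQ.1, hQ.2]
    linarith

/-- The cubic has a root close to `-t a`, a root close to `1 / (t b)`, and a third real root. -/
theorem exists_roots (h : IsLargeParameter a b t c P Q) : ∃ r₁ r₂ r₃ : ℝ,
    (∀ x : ℝ, x ^ 3 + P * x ^ 2 + Q * x + 1 = (x - r₁) * (x - r₂) * (x - r₃)) ∧
    |(t : ℝ)| * |(a : ℝ)| / 2 ≤ |r₁| ∧ |r₁| ≤ 2 * (|(t : ℝ)| * |(a : ℝ)|) ∧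
    1 / (2 * (|(t : ℝ)| * |(b : ℝ)|)) ≤ |r₃| ∧ |r₃| ≤ 2 / (|(t : ℝ)| * |(b : ℝ)|) := by
  have ha1 : (1 : ℝ) ≤ |(a : ℝ)| := by exact_mod_cast h.a_pos
  have hb1 : (1 : ℝ) ≤ |(b : ℝ)| := by
    have := h.a_lt_b
    have := h.a_pos
    have : 1 ≤ |b| := by omega
    exact_mod_cast this
  have hP : |(P : ℝ) - t * a| ≤ |(a : ℝ)| ^ 3 + |(b : ℝ)| := by exact_mod_cast h.abs_P_sub_le
  have hQ : |(Q : ℝ) + t * b| ≤ |(a : ℝ)| ^ 3 := by exact_mod_cast h.abs_Q_add_le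
  have ha : 1000 * |(a : ℝ)| ^ 3 ≤ |(t : ℝ)| := by exact_mod_cast h.ha
  have hb : 1000 * |(b : ℝ)| ≤ |(t : ℝ)| := by exact_mod_cast h.hb
  have hab : |(a : ℝ)| ≤ |(b : ℝ)| := by exact_mod_cast h.a_lt_b.le
  have ht : 1000 ≤ |(t : ℝ)| := by linarith
  have ht0 : (t : ℝ) ≠ 0 := by
    intro e
    rw [e] at ht
    norm_num at ht
  have ha0 : (a : ℝ) ≠ 0 := by
    intro e
    rw [e] at ha1
    norm_num at ha1
  have hb0 : (b : ℝ) ≠ 0 := by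
    intro e
    rw [e] at hb1
    norm_num at hb1
  have hta : 1000 ≤ |(t : ℝ) * a| := by rw [abs_mul]; nlinarith
  have htb : 1000 ≤ |(t : ℝ) * b| := by rw [abs_mul]; nlinarith
  have hta' : |(t : ℝ)| ≤ |(t : ℝ) * a| := by rw [abs_mul]; nlinarith
  have htb' : |(t : ℝ)| ≤ |(t : ℝ) * b| := by rw [abs_mul]; nlinarith
  have hcube : ∀ y : ℝ, 1000 ≤ |y| → |1 / y ^ 3| ≤ 1 / 32 := by
    intro y hy
    rw [abs_div, abs_pow, abs_one, div_le_iff₀ (by positivity)]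
    nlinarith [pow_le_pow_left₀ (by norm_num) hy 3]
  have hPabs : |(P : ℝ)| ≤ 2 * |(t : ℝ) * b| := by
    have : (P : ℝ) = (P - t * a) + t * a := by ring
    rw [this]
    refine (abs_add_le _ _).trans ?_
    have h1 : |(t : ℝ) * a| ≤ |(t : ℝ) * b| := by
      rw [abs_mul, abs_mul]
      exact mul_le_mul_of_nonneg_left hab (abs_nonneg _)
    linarith
  have hQabs : |(Q : ℝ)| ≤ |(t : ℝ)| ^ 2 / 500 := by
    have : (Q : ℝ) = (Q + t * b) - t * b := by ring
    rw [this]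
    refine (abs_sub _ _).trans ?_
    rw [abs_mul]
    nlinarith
  -- Substituting `x = -k t a` and dividing by `-(t a)³` gives a perturbation of `k³ - k²`, with a
  -- root near `1`.
  obtain ⟨k₁, ⟨hk1, hk1'⟩, hk₁⟩ := exists_root_cubic_near_one (p := P / (t * a))
    (q := Q / (t * a) ^ 2) (s := -(1 / (t * a : ℝ) ^ 3))
    (by
      rw [div_sub_one (mul_ne_zero ht0 ha0), abs_div, div_le_iff₀ (by linarith)]
      linarith)
    (by
      rw [abs_div, abs_pow, div_le_iff₀ (by positivity)]
      nlinarith [pow_le_pow_left₀ (abs_nonneg _) hta' 2])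
    (by rw [abs_neg]; exact hcube _ hta)
  -- Substituting `x = k / (t b)` gives a perturbation of `1 - k`.
  obtain ⟨k₃, ⟨hk3, hk3'⟩, hk₃⟩ := exists_root_reverse_cubic_near_one (p := -Q / (t * b))
    (q := P / (t * b) ^ 2) (s := 1 / (t * b : ℝ) ^ 3)
    (by
      rw [div_sub_one (mul_ne_zero ht0 hb0), abs_div, div_le_iff₀ (by linarith)]
      have : -(Q : ℝ) - t * b = -(Q + t * b) := by ring
      rw [this, abs_neg]
      linarith)
    (by
      rw [abs_div, abs_pow, div_le_iff₀ (by positivity)]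
      nlinarith)
    (hcube _ htb)
  have e1 : (-(k₁ * (t * a)) : ℝ) ^ 3 + P * (-(k₁ * (t * a))) ^ 2 + Q * (-(k₁ * (t * a))) + 1
      = 0 := by
    field_simp at hk₁
    linear_combination -hk₁
  have e3 : (k₃ / (t * b) : ℝ) ^ 3 + P * (k₃ / (t * b)) ^ 2 + Q * (k₃ / (t * b)) + 1 = 0 := by
    rw [← hk₃]
    field_simp
    ring
  have habs1 : |-(k₁ * (t * a) : ℝ)| = k₁ * (|(t : ℝ)| * |(a : ℝ)|) := by
    rw [abs_neg, abs_mul, abs_mul, abs_of_nonneg (by linarith)]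
  have habs3 : |(k₃ / (t * b) : ℝ)| = k₃ / (|(t : ℝ)| * |(b : ℝ)|) := by
    rw [abs_div, abs_mul, abs_of_nonneg (by linarith)]
  have hta0 : 1000 ≤ |(t : ℝ)| * |(a : ℝ)| := by rwa [abs_mul] at hta
  have htb0 : 1000 ≤ |(t : ℝ)| * |(b : ℝ)| := by rwa [abs_mul] at htb
  have b1 : |(t : ℝ)| * |(a : ℝ)| / 2 ≤ |-(k₁ * (t * a) : ℝ)| := by rw [habs1]; nlinarith
  have b1' : |-(k₁ * (t * a) : ℝ)| ≤ 2 * (|(t : ℝ)| * |(a : ℝ)|) := by rw [habs1]; nlinarith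
  have b3 : 1 / (2 * (|(t : ℝ)| * |(b : ℝ)|)) ≤ |(k₃ / (t * b) : ℝ)| := by
    rw [habs3, ← div_div]
    exact div_le_div_of_nonneg_right hk3 (by linarith)
  have b3' : |(k₃ / (t * b) : ℝ)| ≤ 2 / (|(t : ℝ)| * |(b : ℝ)|) := by
    rw [habs3]
    exact div_le_div_of_nonneg_right hk3' (by linarith)
  have b3'' : 2 / (|(t : ℝ)| * |(b : ℝ)|) ≤ 1 := by
    rw [div_le_one (by linarith)]
    linarith
  have hne : -(k₁ * (t * a) : ℝ) - k₃ / (t * b) ≠ 0 := by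
    intro e
    rw [sub_eq_zero.1 e] at b1
    linarith
  generalize -(k₁ * (t * a) : ℝ) = r₁ at *
  generalize (k₃ / (t * b) : ℝ) = r₃ at *
  refine ⟨r₁, -P - r₁ - r₃, r₃, ?_, b1, b1', b3, b3'⟩
  have hq : r₁ ^ 2 + r₁ * r₃ + r₃ ^ 2 + P * (r₁ + r₃) + Q = 0 := by
    apply mul_left_cancel₀ hne
    linear_combination e1 - e3
  intro x
  linear_combination (x - r₁) * hq + e1

end IsLargeParameter

/-- Each factor `2` costs at most `1`, as `log 2 ≤ 1`. This yields the integer error bounds in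
`IsLogModel`. -/
theorem abs_log_sub_le {x y : ℝ} {n : ℕ} (hy : 0 < y) (h1 : y / 2 ^ n ≤ x) (h2 : x ≤ 2 ^ n * y) :
    |Real.log x - Real.log y| ≤ n := by
  have hx : 0 < x := lt_of_lt_of_le (by positivity) h1
  have hlog2 : Real.log 2 ≤ 1 := by linarith [Real.log_two_lt_d9]
  have hn : (n : ℝ) * Real.log 2 ≤ n := by
    nlinarith [Nat.cast_nonneg (α := ℝ) n]
  have l1 := Real.log_le_log (by positivity) h1
  have l2 := Real.log_le_log hx h2
  rw [Real.log_div hy.ne' (by positivity), Real.log_pow] at l1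
  rw [Real.log_mul (by positivity) hy.ne', Real.log_pow] at l2
  rw [abs_le]
  constructor <;> linarith

theorem exists_perm_of_ne {i j : Fin 3} (h : i ≠ j) :
    ∃ e : Equiv.Perm (Fin 3), e 0 = i ∧ e 2 = j := by
  revert i j
  decide

theorem IsCubicDatum.comp_perm {θ : ℝ} {P Q : ℤ} {σ : Fin 3 → (ℚ⟮θ⟯ →+* ℝ)}
    (h : IsCubicDatum θ P Q σ) (e : Equiv.Perm (Fin 3)) : IsCubicDatum θ P Q (σ ∘ e) :=
  ⟨h.root, h.no_rat, h.inj.comp e.injective⟩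

/-- The discriminant of the cubic polynomial. -/
theorem IsCubicDatum.conjVandermonde_sq {θ : ℝ} {P Q : ℤ} {σ : Fin 3 → (ℚ⟮θ⟯ →+* ℝ)}
    (h : IsCubicDatum θ P Q σ) : conjVandermonde σ (rootGen θ) ^ 2 =
      P ^ 2 * Q ^ 2 - 4 * Q ^ 3 - 4 * P ^ 3 + 18 * P * Q - 27 := by
  obtain ⟨e1, e2, e3⟩ := h.vieta
  rw [conjVandermonde]
  generalize σ 0 (rootGen θ) = x at *
  generalize σ 1 (rootGen θ) = y at *
  generalize σ 2 (rootGen θ) = z at *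
  have hP : (P : ℝ) = -(x + y + z) := by linarith
  rw [← e2, hP]
  linear_combination (-4 * (x + y + z) ^ 3 + 18 * (x + y + z) * (x * y + x * z + y * z)
    - 27 * (x * y * z - 1)) * e3

theorem IsCubicDatum.abs_conjVandermonde_comp {θ : ℝ} {P Q : ℤ} {σ : Fin 3 → (ℚ⟮θ⟯ →+* ℝ)}
    (h : IsCubicDatum θ P Q σ) (e : Equiv.Perm (Fin 3)) :
    |conjVandermonde (σ ∘ e) (rootGen θ)| = |conjVandermonde σ (rootGen θ)| := by
  rw [← sq_eq_sq_iff_abs_eq_abs, h.conjVandermonde_sq, (h.comp_perm e).conjVandermonde_sq]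

theorem rootGen_mem_unitSet {θ : ℝ} {P Q : ℤ} (h : θ ^ 3 + P * θ ^ 2 + Q * θ + 1 = 0) :
    rootGen θ ∈ unitSet (rootOrder θ) := by
  have hg := rootGen_cubic h
  refine mem_unitSet_iff.2 ⟨(mem_rootOrder_iff h).2 ⟨![0, 1, 0], by simp⟩,
    _, (mem_rootOrder_iff h).2 ⟨![-Q, -P, -1], rfl⟩, ?_⟩
  simp only [Matrix.cons_val_zero, Matrix.cons_val_one, Matrix.cons_val]
  push_cast
  linear_combination -hg

/-- The relations between the coefficients give `a³ h(b / a) = 1`, the terms in `t` cancelling. The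
inverse is minus the quotient of `a³ (h(x) - h(b / a))` by `a x - b`, taken at `θ`. -/
theorem IsLargeParameter.linear_mem_unitSet {θ : ℝ} {a b t c P Q : ℤ}
    (hl : IsLargeParameter a b t c P Q) (h : θ ^ 3 + P * θ ^ 2 + Q * θ + 1 = 0) :
    (a : ℚ⟮θ⟯) * rootGen θ - b ∈ unitSet (rootOrder θ) := by
  have hg := rootGen_cubic h
  refine mem_unitSet_iff.2 ⟨(mem_rootOrder_iff h).2 ⟨![-b, a, 0], by simp; ring⟩,
    _, (mem_rootOrder_iff h).2 ⟨![-(a ^ 2 * Q + a * b * P + b ^ 2), -(a ^ 2 * P + a * b), -a ^ 2],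
      rfl⟩, ?_⟩
  simp only [Matrix.cons_val_zero, Matrix.cons_val_one, Matrix.cons_val]
  have hbc : (b : ℚ⟮θ⟯) * c = a ^ 3 - 1 := by exact_mod_cast hl.bc
  have hP : (a : ℚ⟮θ⟯) * (P - t * a) = c ^ 2 - b := by exact_mod_cast hl.hP
  have hQ : (Q : ℚ⟮θ⟯) = -(a * c) - t * b := by exact_mod_cast hl.hQ
  push_cast
  linear_combination -(a : ℚ⟮θ⟯) ^ 3 * hg + (b : ℚ⟮θ⟯) ^ 2 * hP + (a : ℚ⟮θ⟯) ^ 2 * b * hQ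
    + ((b : ℚ⟮θ⟯) * c - 1) * hbc

/-- Two vectors `u, v` with sum zero that agree, up to bounded errors, with the vectors
`(L + A, B - A, -L - B)` and `(L + 2 A, -L - 2 A - B, B)`, together with a lower bound `d` for half
the logarithm of the discriminant. -/
structure IsLogModel (L A B : ℝ) (u v : E3) (d : ℝ) : Prop where
  hA : 0 ≤ A
  hAB : A ≤ B
  hAL : 3 * A ≤ L
  hBL : B ≤ L
  u0 : |u 0 - (L + A)| ≤ 1
  u1 : |u 1 - (B - A)| ≤ 2
  u2 : |u 2 - (-L - B)| ≤ 1
  v0 : |v 0 - (L + 2 * A)| ≤ 2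
  v1 : |v 1 - (-L - 2 * A - B)| ≤ 3
  v2 : |v 2 - B| ≤ 1
  sum_u : ∑ i, u i = 0
  sum_v : ∑ i, v i = 0
  disc : 2 * L + A + B - 7 ≤ d

/-- The product condition puts `|y|` within a factor `4` of `B / A`, so the three roots have
different orders of magnitude. The differences are at least `τ A / 4`, `τ A / 4` and `|y| / 2`,
which accounts for `2 ^ 7`. -/
theorem abs_vandermonde_lower {x y z τ A B : ℝ} (hA : 1 ≤ A) (hAB : A ≤ B) (hB : 1000 * B ≤ τ)
    (hx : τ * A / 2 ≤ |x|) (hx' : |x| ≤ 2 * (τ * A)) (hz : 1 / (2 * (τ * B)) ≤ |z|)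
    (hz' : |z| ≤ 2 / (τ * B)) (hxyz : |x| * |y| * |z| = 1) :
    τ ^ 2 * A * B / 2 ^ 7 ≤ |(y - x) * (z - x) * (z - y)| := by
  have hτ : 1000 ≤ τ := by linarith
  have hτB : 1000 ≤ τ * B := by nlinarith
  have hτA : 1000 ≤ τ * A := by nlinarith
  have hx0 : 0 < |x| := by linarith
  have hz0 : 0 < |z| := lt_of_lt_of_le (by positivity) hz
  have hz1 : |z| * (τ * B) ≤ 2 := by rwa [le_div_iff₀ (by linarith)] at hz'
  have hz2 : 1 ≤ |z| * (2 * (τ * B)) := by rwa [div_le_iff₀ (by linarith)] at hz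
  have hzs : |z| ≤ 1 / 500 := by nlinarith
  have hy1 : A * |y| ≤ 4 * B := by
    have h1 : τ * A * |y| * |z| ≤ 2 := by
      have : τ * A / 2 * (|y| * |z|) ≤ |x| * (|y| * |z|) := by gcongr
      linarith
    have h2 : τ * A * |y| ≤ τ * A * |y| * (|z| * (2 * (τ * B))) :=
      le_mul_of_one_le_right (by positivity) hz2
    have h3 : τ * (A * |y|) ≤ τ * (4 * B) := by
      calc τ * (A * |y|) ≤ (τ * A * |y| * |z|) * (2 * (τ * B)) := by linarith
        _ ≤ 2 * (2 * (τ * B)) := by gcongr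
        _ = τ * (4 * B) := by ring
    exact le_of_mul_le_mul_left h3 (by linarith)
  have hy2 : B ≤ 4 * (A * |y|) := by
    have h1 : 1 ≤ 2 * (τ * A) * (|y| * |z|) := by
      have : |x| * (|y| * |z|) ≤ 2 * (τ * A) * (|y| * |z|) := by gcongr
      linarith
    have h2 : τ * B ≤ (2 * (τ * A) * |y|) * (|z| * (τ * B)) := by
      have : τ * B * 1 ≤ τ * B * (2 * (τ * A) * (|y| * |z|)) := by gcongr
      linarith
    have h3 : τ * B ≤ τ * (4 * (A * |y|)) := by
      calc τ * B ≤ (2 * (τ * A) * |y|) * (|z| * (τ * B)) := h2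
        _ ≤ (2 * (τ * A) * |y|) * 2 := by gcongr
        _ = τ * (4 * (A * |y|)) := by ring
    exact le_of_mul_le_mul_left h3 (by linarith)
  have hy3 : |y| ≤ τ / 250 := by nlinarith [abs_nonneg y]
  have hy4 : 1 / 4 ≤ |y| := by nlinarith [abs_nonneg y]
  have d1 : τ * A / 4 ≤ |y - x| := by
    have := abs_sub_abs_le_abs_sub x y
    rw [abs_sub_comm] at this
    nlinarith
  have d2 : τ * A / 4 ≤ |z - x| := by
    have := abs_sub_abs_le_abs_sub x z
    rw [abs_sub_comm] at this
    linarith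
  have d3 : |y| / 2 ≤ |z - y| := by
    have := abs_sub_abs_le_abs_sub y z
    rw [abs_sub_comm] at this
    linarith
  rw [abs_mul, abs_mul]
  calc τ ^ 2 * A * B / 2 ^ 7 ≤ τ ^ 2 * A * (4 * (A * |y|)) / 2 ^ 7 := by gcongr
    _ = (τ * A / 4) * (τ * A / 4) * (|y| / 2) := by ring
    _ ≤ |y - x| * |z - x| * |z - y| := by gcongr

theorem abs_log_linear_large {a b x τ : ℝ} (hτ : 0 < τ) (ha : 1 ≤ |a|) (hb : 1000 * |b| ≤ τ)
    (hx : τ * |a| / 2 ≤ |x|) (hx' : |x| ≤ 2 * (τ * |a|)) :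
    |Real.log |a * x - b| - (Real.log τ + 2 * Real.log |a|)| ≤ 2 := by
  have hlog : Real.log τ + 2 * Real.log |a| = Real.log (τ * |a| ^ 2) := by
    rw [Real.log_mul hτ.ne' (by positivity), Real.log_pow]
    norm_num
  have l1 := abs_sub_abs_le_abs_sub (a * x) b
  have l2 := abs_sub (a * x) b
  rw [abs_mul] at l1 l2
  have hτa : τ ≤ τ * |a| ^ 2 := le_mul_of_one_le_right hτ.le (one_le_pow₀ ha)
  have m1 : |a| * (τ * |a| / 2) ≤ |a| * |x| := by gcongr
  have m2 : |a| * |x| ≤ |a| * (2 * (τ * |a|)) := by gcongr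
  rw [hlog]
  refine (abs_log_sub_le (n := 2) (by positivity) ?_ ?_).trans (by norm_num)
  · linarith
  · linarith

theorem abs_log_linear_small {a b x : ℝ} (hx : |a| * |x| ≤ 1) (hb : 2 ≤ |b|) :
    abs (Real.log |a * x - b| - Real.log |b|) ≤ 1 := by
  have l1 := abs_sub_abs_le_abs_sub b (a * x)
  have l2 := abs_sub (a * x) b
  rw [abs_sub_comm] at l1
  rw [abs_mul] at l1 l2
  refine (abs_log_sub_le (n := 1) (by linarith) ?_ ?_).trans (by norm_num)
  · linarith
  · linarith

/-- After a permutation of the embeddings, the logarithms of the two units are known up to bounded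
errors. -/
theorem IsLargeParameter.exists_isLogModel {θ : ℝ} {a b t c P Q : ℤ}
    (hl : IsLargeParameter a b t c P Q) {σ : Fin 3 → (ℚ⟮θ⟯ →+* ℝ)} (h : IsCubicDatum θ P Q σ) :
    ∃ e : Equiv.Perm (Fin 3), IsLogModel (Real.log |(t : ℝ)|) (Real.log |(a : ℝ)|)
      (Real.log |(b : ℝ)|) (logEmbedding (σ ∘ e) (rootGen θ))
      (logEmbedding (σ ∘ e) (a * rootGen θ - b))
      (Real.log |conjVandermonde (σ ∘ e) (rootGen θ)|) := by
  obtain ⟨r₁, r₂, r₃, hr, h1, h1', h3, h3'⟩ := hl.exists_roots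
  have ha1 : (1 : ℝ) ≤ |(a : ℝ)| := by exact_mod_cast hl.a_pos
  have hab : |(a : ℝ)| ≤ |(b : ℝ)| := by exact_mod_cast hl.a_lt_b.le
  have hb1 : (2 : ℝ) ≤ |(b : ℝ)| := by
    have := hl.a_lt_b
    have := hl.a_pos
    have : 2 ≤ |b| := by omega
    exact_mod_cast this
  have ha : 1000 * |(a : ℝ)| ^ 3 ≤ |(t : ℝ)| := by exact_mod_cast hl.ha
  have hb : 1000 * |(b : ℝ)| ≤ |(t : ℝ)| := by exact_mod_cast hl.hb
  obtain ⟨e1, e2, e3⟩ := h.vieta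
  have hfac : ∀ x : ℝ, x ^ 3 + P * x ^ 2 + Q * x + 1 =
      (x - σ 0 (rootGen θ)) * (x - σ 1 (rootGen θ)) * (x - σ 2 (rootGen θ)) := by
    intro x
    linear_combination x ^ 2 * e1 - x * e2 + e3
  have hex : ∀ r : ℝ, (r - r₁) * (r - r₂) * (r - r₃) = 0 → ∃ i, σ i (rootGen θ) = r := by
    intro r h0
    rw [← hr, hfac] at h0
    rcases mul_eq_zero.1 h0 with h0 | h0
    · rcases mul_eq_zero.1 h0 with h0 | h0
      · exact ⟨0, (sub_eq_zero.1 h0).symm⟩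
      · exact ⟨1, (sub_eq_zero.1 h0).symm⟩
    · exact ⟨2, (sub_eq_zero.1 h0).symm⟩
  obtain ⟨i, hi⟩ := hex r₁ (by simp)
  obtain ⟨j, hj⟩ := hex r₃ (by simp)
  have ht : 2000 ≤ |(t : ℝ)| := by linarith
  have hta : 2000 ≤ |(t : ℝ)| * |(a : ℝ)| := by nlinarith
  have htb : 2000 ≤ |(t : ℝ)| * |(b : ℝ)| := by nlinarith
  have h3small : |r₃| * (|(t : ℝ)| * |(b : ℝ)|) ≤ 2 := by
    rwa [le_div_iff₀ (by linarith)] at h3'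
  have hr3 : |r₃| ≤ 1 := by nlinarith [abs_nonneg r₃]
  have hij : i ≠ j := by
    rintro rfl
    rw [hi] at hj
    rw [hj] at h1
    linarith
  -- The order of the embeddings is arbitrary; `e` places the large root at `0` and the small root
  -- at `2`.
  obtain ⟨e, he0, he2⟩ := exists_perm_of_ne hij
  refine ⟨e, ?_⟩
  have h' := h.comp_perm e
  have hu := rootGen_mem_unitSet h.root
  have hv := hl.linear_mem_unitSet h.root
  have hsu := h'.sum_logEmbedding hu
  have hsv := h'.sum_logEmbedding hv
  have hx0 : (σ ∘ e) 0 (rootGen θ) = r₁ := by rw [Function.comp, he0, hi]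
  have hx2 : (σ ∘ e) 2 (rootGen θ) = r₃ := by rw [Function.comp, he2, hj]
  have hnorm := h'.abs_norm_unit hu
  rw [hx0, hx2] at hnorm
  have u0 : |logEmbedding (σ ∘ e) (rootGen θ) 0 - (Real.log |(t : ℝ)| + Real.log |(a : ℝ)|)| ≤ 1 := by
    simp only [logEmbedding]
    rw [hx0, ← Real.log_mul (by linarith) (by linarith)]
    exact (abs_log_sub_le (n := 1) (by linarith) (by linarith) (by linarith)).trans (by norm_num)
  have u2 : |logEmbedding (σ ∘ e) (rootGen θ) 2 - (-Real.log |(t : ℝ)| - Real.log |(b : ℝ)|)| ≤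
      1 := by
    simp only [logEmbedding]
    have hlog : -Real.log |(t : ℝ)| - Real.log |(b : ℝ)| =
        Real.log (1 / (|(t : ℝ)| * |(b : ℝ)|)) := by
      rw [one_div, Real.log_inv, Real.log_mul (by linarith) (by linarith)]
      ring
    rw [hx2, hlog]
    refine (abs_log_sub_le (n := 1) (by positivity) (le_trans (le_of_eq ?_) h3)
      (h3'.trans (le_of_eq ?_))).trans (by norm_num)
    · field_simp
    · ring
  have hva : ∀ i, (σ ∘ e) i (a * rootGen θ - b) = a * (σ ∘ e) i (rootGen θ) - b := by
    intro i
    simp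
  have v0 : |logEmbedding (σ ∘ e) (a * rootGen θ - b) 0 -
      (Real.log |(t : ℝ)| + 2 * Real.log |(a : ℝ)|)| ≤ 2 := by
    simp only [logEmbedding]
    rw [hva, hx0]
    exact abs_log_linear_large (by linarith) ha1 hb h1 h1'
  have v2 : abs (logEmbedding (σ ∘ e) (a * rootGen θ - b) 2 - Real.log |(b : ℝ)|) ≤ 1 := by
    have hsm : |(a : ℝ)| * |r₃| ≤ 1 := by nlinarith [abs_nonneg r₃]
    simp only [logEmbedding]
    rw [hva, hx2]
    exact abs_log_linear_small hsm hb1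
  have hV := abs_vandermonde_lower ha1 hab hb h1 h1' h3 h3' hnorm
  have hlV := Real.log_le_log (by positivity) hV
  have hl2 : Real.log 2 ≤ 1 := by linarith [Real.log_two_lt_d9]
  rw [Real.log_div (by positivity) (by positivity), Real.log_mul (by positivity) (by positivity),
    Real.log_mul (by positivity) (by positivity), Real.log_pow, Real.log_pow] at hlV
  push_cast at hlV
  refine ⟨Real.log_nonneg ha1, Real.log_le_log (by linarith) hab, ?_,
    Real.log_le_log (by linarith) (by linarith), u0, ?_, u2, v0, ?_, v2, hsu, hsv, ?_⟩
  · have : (3 : ℝ) * Real.log |(a : ℝ)| = Real.log (|(a : ℝ)| ^ 3) := by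
      rw [Real.log_pow]
      norm_num
    rw [this]
    exact Real.log_le_log (by positivity) (by nlinarith [pow_pos (by linarith : 0 < |(a : ℝ)|) 3])
  -- The middle coordinate is not estimated directly: it is minus the sum of the other two, and the
  -- errors add.
  · rw [Fin.sum_univ_three] at hsu
    rw [abs_le] at u0 u2 ⊢
    constructor <;> linarith [u0.1, u0.2, u2.1, u2.2]
  · rw [Fin.sum_univ_three] at hsv
    rw [abs_le] at v0 v2 ⊢
    constructor <;> linarith [v0.1, v0.2, v2.1, v2.2]
  · rw [conjVandermonde, hx0, hx2]
    linarith

namespace IsLogModel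

variable {L A B : ℝ} {u v : E3} {d : ℝ}

theorem abs_mul_sub_mul_le {x y X Y ε δ : ℝ} (hx : |x - X| ≤ ε) (hy : |y - Y| ≤ δ) :
    |x * y - X * Y| ≤ |X| * δ + |Y| * ε + ε * δ := by
  have : x * y - X * Y = X * (y - Y) + Y * (x - X) + (x - X) * (y - Y) := by ring
  rw [this]
  refine (abs_add_three _ _ _).trans ?_
  rw [abs_mul, abs_mul, abs_mul]
  have := (abs_nonneg _).trans hx
  gcongr

/-- The determinant of the two vectors, in the coordinates `x₀ - x₂`, `x₁ - x₂`. -/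
theorem abs_det_sub_le (h : IsLogModel L A B u v d) :
    |((u 0 - u 2) * (v 1 - v 2) - (u 1 - u 2) * (v 0 - v 2)) +
      3 * (L ^ 2 + 2 * L * (A + B) + 3 * A * B)| ≤ 40 * L + 17 := by
  have u0 := h.u0
  have u1 := h.u1
  have u2 := h.u2
  have v0 := h.v0
  have v1 := h.v1
  have v2 := h.v2
  have hA := h.hA
  have hAB := h.hAB
  have hAL := h.hAL
  have hBL := h.hBL
  rw [abs_le] at u0 u1 u2 v0 v1 v2
  have p1 : |(u 0 - u 2) - (2 * L + A + B)| ≤ 2 := by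
    rw [abs_le]; constructor <;> linarith [u0.1, u0.2, u2.1, u2.2]
  have p2 : |(u 1 - u 2) - (L + 2 * B - A)| ≤ 3 := by
    rw [abs_le]; constructor <;> linarith [u1.1, u1.2, u2.1, u2.2]
  have p3 : |(v 0 - v 2) - (L + 2 * A - B)| ≤ 3 := by
    rw [abs_le]; constructor <;> linarith [v0.1, v0.2, v2.1, v2.2]
  have p4 : |(v 1 - v 2) - (-(L + 2 * A + 2 * B))| ≤ 4 := by
    rw [abs_le]; constructor <;> linarith [v1.1, v1.2, v2.1, v2.2]
  have q1 := abs_mul_sub_mul_le p1 p4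
  have q2 := abs_mul_sub_mul_le p2 p3
  rw [abs_neg, abs_of_nonneg (by linarith : 0 ≤ 2 * L + A + B),
    abs_of_nonneg (by linarith : 0 ≤ L + 2 * A + 2 * B)] at q1
  rw [abs_of_nonneg (by linarith : 0 ≤ L + 2 * B - A),
    abs_of_nonneg (by linarith : 0 ≤ L + 2 * A - B)] at q2
  rw [abs_le] at q1 q2 ⊢
  constructor
  · nlinarith [q1.1, q2.2]
  · nlinarith [q1.2, q2.1]

theorem det_neg (h : IsLogModel L A B u v d) (hL : 1000 ≤ L) :
    (u 0 - u 2) * (v 1 - v 2) - (u 1 - u 2) * (v 0 - v 2) < 0 := by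
  have hdet := (abs_le.1 h.abs_det_sub_le).2
  have hA := h.hA
  have hB := h.hA.trans h.hAB
  have : 0 ≤ 2 * L * (A + B) + 3 * A * B := by positivity
  nlinarith

/-- In leading order, `6 (L² + 2L(A + B) + 3AB) < 3 (2L + A + B)²` amounts to `6AB < 2L² + (A +
B)²`. This follows from `4AB ≤ (A + B)²` and `A + B ≤ 4L / 3`; the gap, quadratic in `L`, absorbs
the linear errors. -/
theorem det_small (h : IsLogModel L A B u v d) (hL : 1000 ≤ L) {m : ℝ} (hm : d - 3 ≤ m) :
    2 * |(u 0 - u 2) * (v 1 - v 2) - (u 1 - u 2) * (v 0 - v 2)| < 3 * m ^ 2 := by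
  have hdet := (abs_le.1 h.abs_det_sub_le).1
  have hA := h.hA
  have hB := h.hA.trans h.hAB
  have hAL := h.hAL
  have hBL := h.hBL
  have hd := h.disc
  rw [abs_of_neg (h.det_neg hL)]
  have h1 : 2 * L + A + B - 10 ≤ m := by linarith
  have h2 : (2 * L + A + B - 10) ^ 2 ≤ m ^ 2 := pow_le_pow_left₀ (by linarith) h1 2
  have h3 : 4 * (A * B) ≤ (A + B) ^ 2 := by nlinarith [sq_nonneg (A - B)]
  have h4 : (A + B) ^ 2 ≤ (4 / 3 * L) ^ 2 := pow_le_pow_left₀ (by linarith) (by linarith) 2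
  nlinarith

end IsLogModel

/-! ### Fundamental units -/

/-- The two units generate the group of units up to sign. -/
theorem IsLargeParameter.exists_int_combination {θ : ℝ} {a b t c P Q : ℤ}
    (hl : IsLargeParameter a b t c P Q) {σ : Fin 3 → (ℚ⟮θ⟯ →+* ℝ)} (h : IsCubicDatum θ P Q σ)
    {L A B : ℝ} (hL : 1000 ≤ L)
    (hm : IsLogModel L A B (logEmbedding σ (rootGen θ)) (logEmbedding σ (a * rootGen θ - b))
      (Real.log |conjVandermonde σ (rootGen θ)|))
    {α : ℚ⟮θ⟯} (hα : α ∈ unitSet (rootOrder θ)) :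
    ∃ m n : ℤ, logEmbedding σ α =
      m • logEmbedding σ (rootGen θ) + n • logEmbedding σ (a * rootGen θ - b) := by
  set V := |conjVandermonde σ (rootGen θ)| with hV
  have hVpos : 0 < V := abs_pos.2 h.conjVandermonde_ne_zero
  let f : E3 →+ (Fin 2 → ℝ) :=
    { toFun := fun x => ![x 0 - x 2, x 1 - x 2]
      map_zero' := by ext i; fin_cases i <;> simp
      map_add' := fun x y => by ext i; fin_cases i <;> simp <;> ring }
  have hf0 : ∀ x, f x 0 = x 0 - x 2 := fun _ => rfl
  have hf1 : ∀ x, f x 1 = x 1 - x 2 := fun _ => rfl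
  have hfinj : ∀ x : E3, ∑ i, x i = 0 → f x = 0 → x = 0 := by
    intro x hx hfx
    rw [Fin.sum_univ_three] at hx
    have e0 : x 0 - x 2 = 0 := congrFun hfx 0
    have e1 : x 1 - x 2 = 0 := congrFun hfx 1
    ext i
    fin_cases i <;> simp <;> linarith
  let Γ : AddSubgroup (Fin 2 → ℝ) :=
    { carrier := (fun α => f (logEmbedding σ α)) '' unitSet (rootOrder θ)
      zero_mem' := ⟨1, one_mem_unitSet _, by simp [logEmbedding_one]⟩
      add_mem' := by
        rintro _ _ ⟨α, hα, rfl⟩ ⟨β, hβ, rfl⟩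
        refine ⟨α * β, mul_mem_unitSet hα hβ, ?_⟩
        simp only [logEmbedding_mul σ (ne_zero_of_mem_unitSet hα) (ne_zero_of_mem_unitSet hβ),
          map_add]
      neg_mem' := by
        rintro _ ⟨α, hα, rfl⟩
        exact ⟨α⁻¹, inv_mem_unitSet hα, by simp only [logEmbedding_inv, map_neg]⟩ }
  have hlog8 : Real.log 8 ≤ 3 := by
    rw [show (8 : ℝ) = 2 ^ 3 by norm_num, Real.log_pow]
    push_cast
    linarith [Real.log_two_lt_d9]
  have hmpos : 0 < Real.log V - Real.log 8 := by
    linarith [hm.disc, hm.hA, hm.hA.trans hm.hAB]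
  have hu := rootGen_mem_unitSet h.root
  have hv := hl.linear_mem_unitSet h.root
  -- The radius is `log (V / 8)`: in a hexagon of this size the conjugates of a unit would have
  -- Vandermonde determinant below `V`. Since `log 8 ≤ 3`, it meets the requirement of `det_small`.
  obtain ⟨m, n, hmn⟩ := exists_int_combination_of_hexagon
    (m := Real.log V - Real.log 8) hmpos Γ
    (by
      rintro _ ⟨α, hα, rfl⟩ h0 h1 h2
      dsimp only at h0 h1 h2 ⊢
      rw [hf0] at h0 h2
      rw [hf1] at h1 h2
      have hs := h.sum_logEmbedding hα
      rcases h.unit_vandermonde hα with hz | hz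
      · rw [hz, map_zero]
      · have hlt := IsCubicDatum.abs_conjVandermonde_lt (ne_zero_of_mem_unitSet hα) hs h0 h1
          (by simpa using h2)
        rw [Real.exp_sub, Real.exp_log hVpos, Real.exp_log (by norm_num)] at hlt
        exact absurd hz (not_le.2 (by linarith)))
    (u := f (logEmbedding σ (rootGen θ))) (v := f (logEmbedding σ (a * rootGen θ - b)))
    ⟨_, hu, rfl⟩ ⟨_, hv, rfl⟩ (hm.det_neg hL).ne (hm.det_small hL (by linarith))
    (w := f (logEmbedding σ α)) ⟨_, hα, rfl⟩
  refine ⟨m, n, sub_eq_zero.1 (hfinj _ ?_ ?_)⟩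
  · have hsα := h.sum_logEmbedding hα
    have hsu := h.sum_logEmbedding hu
    have hsv := h.sum_logEmbedding hv
    simp only [PiLp.sub_apply, PiLp.add_apply, PiLp.smul_apply, Finset.sum_sub_distrib,
      Finset.sum_add_distrib, ← Finset.smul_sum, hsα, hsu, hsv, smul_zero, add_zero, sub_zero]
  · rw [map_sub, hmn, map_add, map_zsmul, map_zsmul, sub_self]

/-! ### Consequences for one large parameter -/

theorem exists_combination_of_det_ne_zero {u v y : E3} (hu : ∑ i, u i = 0) (hv : ∑ i, v i = 0)
    (hy : ∑ i, y i = 0)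
    (hdet : (u 0 - u 2) * (v 1 - v 2) - (u 1 - u 2) * (v 0 - v 2) ≠ 0) :
    ∃ w : Fin 2 → ℝ, y = w 0 • u + w 1 • v := by
  set D := (u 0 - u 2) * (v 1 - v 2) - (u 1 - u 2) * (v 0 - v 2) with hD
  set p := ((y 0 - y 2) * (v 1 - v 2) - (y 1 - y 2) * (v 0 - v 2)) / D with hp
  set q := ((u 0 - u 2) * (y 1 - y 2) - (u 1 - u 2) * (y 0 - y 2)) / D with hq
  have hpD : p * D = (y 0 - y 2) * (v 1 - v 2) - (y 1 - y 2) * (v 0 - v 2) :=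
    div_mul_cancel₀ _ hdet
  have hqD : q * D = (u 0 - u 2) * (y 1 - y 2) - (u 1 - u 2) * (y 0 - y 2) :=
    div_mul_cancel₀ _ hdet
  rw [Fin.sum_univ_three] at hu hv hy
  have h0 : y 0 - y 2 = p * (u 0 - u 2) + q * (v 0 - v 2) := by
    apply mul_right_cancel₀ hdet
    linear_combination -(u 0 - u 2) * hpD - (v 0 - v 2) * hqD
  have h1 : y 1 - y 2 = p * (u 1 - u 2) + q * (v 1 - v 2) := by
    apply mul_right_cancel₀ hdet
    linear_combination -(u 1 - u 2) * hpD - (v 1 - v 2) * hqD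
  have h2 : y 2 = p * u 2 + q * v 2 := by
    linear_combination hy / 3 - p / 3 * hu - q / 3 * hv - h0 / 3 - h1 / 3
  refine ⟨![p, q], ?_⟩
  ext i
  fin_cases i
  · simp
    linear_combination h0 + h2
  · simp
    linear_combination h1 + h2
  · simp
    linear_combination h2

namespace IsLogModel

variable {L A B : ℝ} {u v : E3} {d : ℝ}

/-- On a hexagon of parameters, the coordinates are bounded. -/
theorem combination_le (h : IsLogModel L A B u v d) {p q r : ℝ} (hr : r ≤ 1)
    (h1 : |p + q| ≤ r) (h2 : |2 * p - q| ≤ r) (h3 : |p - 2 * q| ≤ r) (i : Fin 3) :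
    p * u i - q * v i ≤ r * (2 / 3 * L + A + B) + 5 := by
  have hA := h.hA
  have hB := h.hA.trans h.hAB
  have hL : 0 ≤ L := hB.trans h.hBL
  have hr0 : 0 ≤ r := (abs_nonneg _).trans h1
  have hrA : 0 ≤ r * A := mul_nonneg hr0 hA
  have hrB : 0 ≤ r * B := mul_nonneg hr0 hB
  rw [abs_le] at h1 h2 h3
  have hp : |p| ≤ 1 := by rw [abs_le]; constructor <;> linarith [h1.1, h1.2, h2.1, h2.2]
  have hq : |q| ≤ 1 := by rw [abs_le]; constructor <;> linarith [h1.1, h1.2, h3.1, h3.2]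
  have key : ∀ x y X Y δ δ' : ℝ, |x - X| ≤ δ → |y - Y| ≤ δ' →
      p * x - q * y ≤ p * X - q * Y + (δ + δ') := by
    intro x y X Y δ δ' hx hy
    have e1 : p * (x - X) ≤ δ := by
      calc p * (x - X) ≤ |p * (x - X)| := le_abs_self _
        _ = |p| * |x - X| := abs_mul _ _
        _ ≤ 1 * δ := mul_le_mul hp hx (abs_nonneg _) (by norm_num)
        _ = δ := one_mul _
    have e2 : -(q * (y - Y)) ≤ δ' := by
      calc -(q * (y - Y)) ≤ |q * (y - Y)| := neg_le_abs _
        _ = |q| * |y - Y| := abs_mul _ _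
        _ ≤ 1 * δ' := mul_le_mul hq hy (abs_nonneg _) (by norm_num)
        _ = δ' := one_mul _
    linarith
  fin_cases i
  -- The coefficients of `L` in the three coordinates are `p - q`, `q` and `-p`. Each is, up to
  -- signs, a third of a sum of two of the bounded forms, whence `2r / 3`; those of `A` and `B` are
  -- the forms themselves or zero.
  · have k := key _ _ _ _ _ _ h.u0 h.v0
    have e1 : (p - q) * L ≤ 2 / 3 * r * L :=
      mul_le_mul_of_nonneg_right (by linarith [h2.2, h3.2]) hL
    have e2 : (p - 2 * q) * A ≤ r * A := mul_le_mul_of_nonneg_right h3.2 hA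
    simp only [Fin.zero_eta] at k ⊢
    linarith
  · have k := key _ _ _ _ _ _ h.u1 h.v1
    have e1 : q * L ≤ 2 / 3 * r * L :=
      mul_le_mul_of_nonneg_right (by linarith [h1.2, h3.1]) hL
    have e2 : (p + q) * B ≤ r * B := mul_le_mul_of_nonneg_right h1.2 hB
    have e3 : (2 * q - p) * A ≤ r * A := mul_le_mul_of_nonneg_right (by linarith [h3.1]) hA
    simp only [Fin.mk_one] at k ⊢
    linarith
  · have k := key _ _ _ _ _ _ h.u2 h.v2
    have e1 : -p * L ≤ 2 / 3 * r * L :=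
      mul_le_mul_of_nonneg_right (by linarith [h1.1, h2.1]) hL
    have e2 : -(p + q) * B ≤ r * B := mul_le_mul_of_nonneg_right (by linarith [h1.1]) hB
    simp only [Fin.reduceFinMk] at k ⊢
    linarith

end IsLogModel

/-- The data attached to one large parameter: the embeddings form a cubic datum, and the logarithms
of the units are as expected after a permutation `e` of the embeddings. -/
structure IsLargeDatum {θ : ℝ} (a b t c P Q : ℤ) (σ : Fin 3 → (ℚ⟮θ⟯ →+* ℝ))
    (e : Equiv.Perm (Fin 3)) : Prop where
  large : IsLargeParameter a b t c P Q
  datum : IsCubicDatum θ P Q σ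
  large_t : 1000 ≤ Real.log |(t : ℝ)|
  model : IsLogModel (Real.log |(t : ℝ)|) (Real.log |(a : ℝ)|) (Real.log |(b : ℝ)|)
    (logEmbedding (σ ∘ e) (rootGen θ)) (logEmbedding (σ ∘ e) (a * rootGen θ - b))
    (Real.log |conjVandermonde σ (rootGen θ)|)

theorem logEmbedding_comp_perm {K : Type*} [Field K] (σ : Fin 3 → (K →+* ℝ))
    (e : Equiv.Perm (Fin 3)) (α : K) (i : Fin 3) :
    logEmbedding (σ ∘ e) α i = logEmbedding σ α (e i) := rfl

namespace IsLargeDatum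

variable {θ : ℝ} {a b t c P Q : ℤ} {σ : Fin 3 → (ℚ⟮θ⟯ →+* ℝ)} {e : Equiv.Perm (Fin 3)}

theorem gen_mem (h : IsLargeDatum a b t c P Q σ e) : rootGen θ ∈ unitSet (rootOrder θ) :=
  rootGen_mem_unitSet h.datum.root

theorem linear_mem (h : IsLargeDatum a b t c P Q σ e) :
    (a : ℚ⟮θ⟯) * rootGen θ - b ∈ unitSet (rootOrder θ) :=
  h.large.linear_mem_unitSet h.datum.root

theorem exists_combination (h : IsLargeDatum a b t c P Q σ e) {y : E3} (hy : ∑ i, y i = 0) :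
    ∃ w : Fin 2 → ℝ, y = w 0 • logEmbedding σ (rootGen θ) +
      w 1 • logEmbedding σ (a * rootGen θ - b) := by
  have hy' : ∑ i, (WithLp.toLp 2 fun i => y (e i) : E3) i = 0 := by
    rw [← hy]
    exact Equiv.sum_comp e fun i => y i
  obtain ⟨w, hw⟩ := exists_combination_of_det_ne_zero h.model.sum_u h.model.sum_v hy'
    (h.model.det_neg h.large_t).ne
  refine ⟨w, ?_⟩
  ext i
  have := congrArg (fun z : E3 => z (e.symm i)) hw
  simpa [logEmbedding_comp_perm] using this

theorem linearIndependent (h : IsLargeDatum a b t c P Q σ e) :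
    LinearIndependent ℤ ![logEmbedding σ (rootGen θ), logEmbedding σ (a * rootGen θ - b)] := by
  suffices hR : LinearIndependent ℝ
      ![logEmbedding σ (rootGen θ), logEmbedding σ (a * rootGen θ - b)] from
    hR.restrict_scalars' ℤ
  rw [LinearIndependent.pair_iff]
  intro s r hsr
  have hdet := (h.model.det_neg h.large_t).ne
  have hi : ∀ i, s * logEmbedding (σ ∘ e) (rootGen θ) i +
      r * logEmbedding (σ ∘ e) (a * rootGen θ - b) i = 0 := by
    intro i
    have := congrArg (fun z : E3 => z (e i)) hsr
    simpa [logEmbedding_comp_perm] using this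
  have h0 := hi 0
  have h1 := hi 1
  have h2 := hi 2
  constructor
  · apply mul_right_cancel₀ hdet
    linear_combination (logEmbedding (σ ∘ e) (a * rootGen θ - b) 1 -
      logEmbedding (σ ∘ e) (a * rootGen θ - b) 2) * (h0 - h2) -
      (logEmbedding (σ ∘ e) (a * rootGen θ - b) 0 -
      logEmbedding (σ ∘ e) (a * rootGen θ - b) 2) * (h1 - h2)
  · apply mul_right_cancel₀ hdet
    linear_combination (logEmbedding (σ ∘ e) (rootGen θ) 0 -
      logEmbedding (σ ∘ e) (rootGen θ) 2) * (h1 - h2) -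
      (logEmbedding (σ ∘ e) (rootGen θ) 1 -
      logEmbedding (σ ∘ e) (rootGen θ) 2) * (h0 - h2)

theorem isFundamentalSystem (h : IsLargeDatum a b t c P Q σ e) :
    IsFundamentalSystem σ (rootOrder θ) ![rootGen θ, (a : ℚ⟮θ⟯) * rootGen θ - (b : ℚ⟮θ⟯)] := by
  have hfun : (fun j => logEmbedding σ (![rootGen θ, (a : ℚ⟮θ⟯) * rootGen θ - (b : ℚ⟮θ⟯)] j)) =
      ![logEmbedding σ (rootGen θ), logEmbedding σ (a * rootGen θ - b)] := by
    ext j : 1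
    fin_cases j <;> rfl
  refine ⟨?_, ?_, ?_⟩
  · intro j
    fin_cases j
    · exact h.gen_mem
    · exact h.linear_mem
  · rw [hfun]
    exact h.linearIndependent
  · rw [hfun]
    ext z
    rw [SetLike.mem_coe, Submodule.mem_span_range_iff_exists_fun]
    constructor
    · rintro ⟨n, rfl⟩
      refine ⟨rootGen θ ^ n 0 * (a * rootGen θ - b) ^ n 1,
        mul_mem_unitSet (zpow_mem_unitSet h.gen_mem _) (zpow_mem_unitSet h.linear_mem _), ?_⟩
      rw [logEmbedding_mul σ (zpow_ne_zero _ (ne_zero_of_mem_unitSet h.gen_mem))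
        (zpow_ne_zero _ (ne_zero_of_mem_unitSet h.linear_mem)), logEmbedding_zpow,
        logEmbedding_zpow, Fin.sum_univ_two]
      rfl
    · rintro ⟨α, hα, rfl⟩
      have hmod := h.model
      rw [← h.datum.abs_conjVandermonde_comp e] at hmod
      obtain ⟨m, n, hmn⟩ := h.large.exists_int_combination (h.datum.comp_perm e) h.large_t hmod hα
      refine ⟨![m, n], ?_⟩
      ext i
      have := congrArg (fun z : E3 => z (e.symm i)) hmn
      simpa [logEmbedding_comp_perm] using this.symm

theorem isCompact_and_exists (h : IsLargeDatum a b t c P Q σ e) :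
    IsCompact (diagOrbit (pointOf (unimodularLattice σ (rootOrder θ)))) ∧
      ∃ μ, IsOrbitMeasure (pointOf (unimodularLattice σ (rootOrder θ))) μ := by
  have hUV : ∀ y : E3, ∑ j, y j = 0 → ∃ w : Fin 2 → ℝ, y =
      w 0 • ((2 : ℝ) • logEmbedding σ (rootGen θ)) +
        w 1 • ((2 : ℝ) • logEmbedding σ (a * rootGen θ - b)) := by
    intro y hy
    obtain ⟨w, hw⟩ := h.exists_combination hy
    refine ⟨fun i => w i / 2, ?_⟩
    rw [hw, smul_smul, smul_smul, div_mul_cancel₀ _ two_ne_zero, div_mul_cancel₀ _ two_ne_zero]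
  have hU := h.datum.diagExp_smul_pointOf h.gen_mem
  have hV := h.datum.diagExp_smul_pointOf h.linear_mem
  exact ⟨isCompact_diagOrbit hUV hU hV, exists_isOrbitMeasure hUV hU hV⟩

theorem combination_le (h : IsLargeDatum a b t c P Q σ e) {p q r : ℝ} (hr : r ≤ 1)
    (h1 : |p + q| ≤ r) (h2 : |2 * p - q| ≤ r) (h3 : |p - 2 * q| ≤ r) (i : Fin 3) :
    p * logEmbedding σ (rootGen θ) i - q * logEmbedding σ (a * rootGen θ - b) i ≤
      r * (2 / 3 * Real.log |(t : ℝ)| + Real.log |(a : ℝ)| + Real.log |(b : ℝ)|) + 5 := by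
  have := h.model.combination_le hr h1 h2 h3 (e.symm i)
  simpa [logEmbedding_comp_perm] using this

/-- A compact set of lattices has small mass when the discriminant is large. -/
theorem measure_le (h : IsLargeDatum a b t c P Q σ e) {K : Set LatticeSpace}
    (hKm : MeasurableSet K) {ε r : ℝ} (hr0 : 0 ≤ r) (hr : r ≤ 1)
    (hK : ∀ g : SL3R, (g : LatticeSpace) ∈ K → ∀ v ∈ columnLattice g, v ≠ 0 → ε ≤ ‖v‖)
    (hε : 2 * Real.exp (8 - (2 / 3 * (1 - r) * Real.log |(t : ℝ)| +
      (1 / 3 - r) * (Real.log |(a : ℝ)| + Real.log |(b : ℝ)|))) < ε)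
    {μ : Measure LatticeSpace}
    (hμ : IsOrbitMeasure (pointOf (unimodularLattice σ (rootOrder θ))) μ) :
    μ K ≤ ENNReal.ofReal (1 - r ^ 2) := by
  have hsu := h.datum.sum_logEmbedding h.gen_mem
  have hsv := h.datum.sum_logEmbedding h.linear_mem
  set U := logEmbedding σ (rootGen θ) with hU
  set V := logEmbedding σ (a * rootGen θ - b) with hV
  -- The sign of `V` matters: in the basis `U, -V` the tile hexagon has vertex set `W_Φ` for `Φ =
  -- {U, -V, V - U}`.
  have hUV : ∀ y : E3, ∑ j, y j = 0 → ∃ w : Fin 2 → ℝ, y = w 0 • U + w 1 • (-V) := by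
    intro y hy
    obtain ⟨w, hw⟩ := h.exists_combination hy
    refine ⟨![w 0, -w 1], ?_⟩
    rw [hw]
    simp [hU, hV]
  refine hμ.measure_le hUV hKm hr0 hr ?_
  rintro n hn w ⟨hw1, hw2, hw3⟩
  rw [mem_intLattice] at hn
  obtain ⟨n0, hn0⟩ := hn 0
  obtain ⟨n1, hn1⟩ := hn 1
  -- The unit `θ ^ (-n0) (a θ - b) ^ n1` cancels the integer part of the parameter and leaves `w 0 U
  -- - w 1 V`.
  refine h.datum.notMem_of_unit hK ?_
    (mul_mem_unitSet (zpow_mem_unitSet h.gen_mem (-n0)) (zpow_mem_unitSet h.linear_mem n1))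
    (c := r * (2 / 3 * Real.log |(t : ℝ)| + Real.log |(a : ℝ)| + Real.log |(b : ℝ)|) + 5) ?_ ?_
  · simp only [PiLp.add_apply, PiLp.smul_apply, PiLp.neg_apply, Finset.sum_add_distrib,
      ← Finset.smul_sum, Finset.sum_neg_distrib, hsu, hsv, smul_zero, neg_zero, add_zero]
  · intro i
    refine le_trans (le_of_eq ?_) (h.combination_le hr hw1.le hw2.le hw3.le i)
    rw [logEmbedding_mul σ (zpow_ne_zero _ (ne_zero_of_mem_unitSet h.gen_mem))
      (zpow_ne_zero _ (ne_zero_of_mem_unitSet h.linear_mem)), logEmbedding_zpow,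
      logEmbedding_zpow, ← hU, ← hV]
    simp only [PiLp.add_apply, PiLp.smul_apply, PiLp.neg_apply, Pi.add_apply, smul_eq_mul,
      zsmul_eq_mul, ← hn0, ← hn1]
    push_cast
    ring
  -- The constant `8` covers the error `5` of the coordinates and a third of the error `7` of the
  -- discriminant.
  · refine lt_of_le_of_lt ?_ hε
    have hd := h.model.disc
    have : ∀ x y : ℝ, x ≤ y → 2 * Real.exp x ≤ 2 * Real.exp y := fun x y hxy => by gcongr
    apply this
    linarith

/-- The simplex set formed by the units. -/
def _root_.unitSimplex {K : Type*} [Field K] (σ : Fin 3 → (K →+* ℝ)) (α β : K) : Fin 3 → E3 :=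
  ![logEmbedding σ α, -logEmbedding σ β, logEmbedding σ β - logEmbedding σ α]

theorem isUnitSimplexSet (h : IsLargeDatum a b t c P Q σ e) :
    IsUnitSimplexSet σ (rootOrder θ) (unitSimplex σ (rootGen θ) (a * rootGen θ - b)) := by
  have hsu := h.datum.sum_logEmbedding h.gen_mem
  have hsv := h.datum.sum_logEmbedding h.linear_mem
  refine ⟨⟨?_, ?_⟩, ?_⟩
  · ext y
    rw [SetLike.mem_coe, Submodule.mem_span_range_iff_exists_fun]
    constructor
    · rintro ⟨w, rfl⟩
      simp only [Set.mem_ofPred_eq, Fin.sum_univ_three, unitSimplex, PiLp.add_apply,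
        PiLp.smul_apply, Matrix.cons_val_zero, Matrix.cons_val_one, Matrix.cons_val,
        PiLp.neg_apply, PiLp.sub_apply, smul_eq_mul] at hsu hsv ⊢
      linear_combination (w 0 - w 2) * hsu + (w 2 - w 1) * hsv
    · intro hy
      obtain ⟨w, hw⟩ := h.exists_combination hy
      refine ⟨![w 0, -w 1, 0], ?_⟩
      rw [hw, Fin.sum_univ_three]
      simp [unitSimplex]
  · rw [Fin.sum_univ_three]
    simp only [unitSimplex, Matrix.cons_val_zero, Matrix.cons_val_one, Matrix.cons_val]
    abel
  · intro i
    fin_cases i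
    · exact ⟨_, h.gen_mem, rfl⟩
    · exact ⟨_, inv_mem_unitSet h.linear_mem, logEmbedding_inv σ _⟩
    · refine ⟨_, mul_mem_unitSet h.linear_mem (inv_mem_unitSet h.gen_mem), ?_⟩
      rw [logEmbedding_mul σ (ne_zero_of_mem_unitSet h.linear_mem)
        (inv_ne_zero (ne_zero_of_mem_unitSet h.gen_mem)), logEmbedding_inv, ← sub_eq_add_neg]
      rfl

theorem simplexCeil_le (h : IsLargeDatum a b t c P Q σ e) :
    simplexCeil (unitSimplex σ (rootGen θ) (a * rootGen θ - b)) ≤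
      2 / 3 * Real.log |(t : ℝ)| + Real.log |(a : ℝ)| + Real.log |(b : ℝ)| + 5 := by
  have hA := h.model.hA
  have hB := h.model.hA.trans h.model.hAB
  have hL := h.large_t
  refine Real.sSup_le ?_ (by linarith)
  rintro _ ⟨_, ⟨w, hw, rfl⟩, rfl⟩
  have hmem : ∀ i, 0 ≤ w i ∧ w i ≤ 2 / 3 := by
    intro i
    have : w i ∈ ({0, 1 / 3, 2 / 3} : Set ℝ) := hw ▸ Set.mem_range_self i
    rcases this with h | h | h <;> rw [h] <;> norm_num
  -- Three indices cover three distinct values, so `w` is injective and its values add up to `0 +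
  -- 1/3 + 2/3`.
  have hsum : w 0 + w 1 + w 2 = 1 := by
    have himg : Finset.univ.image w = {0, 1 / 3, 2 / 3} := by
      apply Finset.coe_injective
      simpa using hw
    have hcard : (Finset.univ.image w).card = (Finset.univ : Finset (Fin 3)).card := by
      rw [himg, Finset.card_insert_of_notMem, Finset.card_pair]
      · rfl
      · norm_num
      · norm_num
    have hinj := Finset.card_image_iff.1 hcard
    have hs : ∑ x ∈ Finset.univ.image w, x = ∑ i, w i := Finset.sum_image fun x hx y hy => hinj hx hy
    rw [himg, Finset.sum_insert (by norm_num), Finset.sum_pair (by norm_num),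
      Fin.sum_univ_three] at hs
    linarith
  refine ciSup_le fun i => ?_
  -- The three forms become `1 - 3 w 2`, `3 w 0 - 1` and `1 - 3 w 1`, all in `[-1, 1]`.
  have key := h.combination_le (p := w 0 - w 2) (q := w 1 - w 2) le_rfl
    (by rw [abs_le]; constructor <;> linarith [hmem 2])
    (by rw [abs_le]; constructor <;> linarith [hmem 0])
    (by rw [abs_le]; constructor <;> linarith [hmem 1]) i
  refine le_trans (le_of_eq ?_) (key.trans (le_of_eq ?_))
  · rw [Fin.sum_univ_three]
    simp [unitSimplex]
    ring
  · ring

/-- The vector of `1` already gives enough height. The margin `9` pays for `5 r`, for `7 / 3` from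
the discriminant and for `log 2`; the case `R = 1` suffices. -/
theorem isTight (h : IsLargeDatum a b t c P Q σ e) {R r : ℝ} (hR : 1 ≤ R) (hr0 : 0 ≤ r)
    (hr : r < 1) (hlarge : 9 ≤ 2 / 3 * (1 - r) * Real.log |(t : ℝ)| +
      (1 / 3 - r) * (Real.log |(a : ℝ)| + Real.log |(b : ℝ)|)) :
    IsTight σ (rootOrder θ) R r (unitSimplex σ (rootGen θ) (a * rootGen θ - b)) := by
  have h1 := mul_le_mul_of_nonneg_left h.simplexCeil_le hr0
  have h2 := h.datum.le_latticeHeight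
  have hd := h.model.disc
  have hpos : 0 < latticeHeight (unimodularLattice σ (rootOrder θ)) :=
    lt_of_lt_of_le (by positivity) h2
  have hl2 : Real.log 2 ≤ 1 := by linarith [Real.log_two_lt_d9]
  rw [IsTight]
  calc Real.exp (r * simplexCeil (unitSimplex σ (rootGen θ) (a * rootGen θ - b)))
      ≤ Real.exp (1 / 3 * Real.log |conjVandermonde σ (rootGen θ)| - Real.log 2) := by
        apply Real.exp_le_exp.2
        linarith
    _ = Real.exp (1 / 3 * Real.log |conjVandermonde σ (rootGen θ)|) / 2 := by
        rw [Real.exp_sub, Real.exp_log two_pos]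
    _ ≤ latticeHeight (unimodularLattice σ (rootOrder θ)) := h2
    _ ≤ latticeHeight (unimodularLattice σ (rootOrder θ)) * R := le_mul_of_one_le_right hpos.le hR

end IsLargeDatum

/-! ### The family -/

theorem exists_isLargeParameter {a b t : ℤ} (hcub : IsMutuallyCubicRootPair a b) (ha0 : 0 < |a|)
    (hab : |a| < |b|) (ha : 1000 * |a| ^ 3 ≤ |t|) (hb : 1000 * |b| ≤ |t|) :
    ∃ c P Q : ℤ, IsLargeParameter a b t c P Q ∧ cubicPoly a b t = unitCubic P Q := by
  obtain ⟨h1, h2⟩ := hcub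
  have ha' : a ≠ 0 := abs_pos.1 ha0
  have hb' : b ≠ 0 := abs_pos.1 (ha0.trans hab)
  obtain ⟨c, hc⟩ := h1.symm.dvd
  obtain ⟨k, hk⟩ := h2.symm.dvd
  -- Integrality of `P`: `b² (c² - b) = (a³ - 1)² - b³` vanishes modulo `a`, and `b` is invertible
  -- there by the second congruence.
  have hdvd : a ∣ c ^ 2 - b := by
    have hcop : IsCoprime a (b ^ 2) := by
      refine ⟨-k, b, ?_⟩
      linear_combination hk
    refine hcop.dvd_of_dvd_mul_left ⟨a ^ 5 - 2 * a ^ 2 - k, ?_⟩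
    linear_combination -(b * c + a ^ 3 - 1) * hc - hk
  obtain ⟨p, hp⟩ := hdvd
  refine ⟨c, p + t * a, -(a * c) - t * b, ⟨ha0, hab, by linear_combination -hc,
    by linear_combination -hp, rfl, ha, hb⟩, ?_⟩
  have haQ : (a : ℚ) ≠ 0 := by exact_mod_cast ha'
  have hbQ : (b : ℚ) ≠ 0 := by exact_mod_cast hb'
  have hcQ : (a : ℚ) ^ 3 - 1 = b * c := by exact_mod_cast hc
  have hpQ : (c : ℚ) ^ 2 - b = a * p := by exact_mod_cast hp
  have e1 : (((a : ℚ) ^ 3 - 1) ^ 2 - (b : ℚ) ^ 3) / ((a : ℚ) * (b : ℚ) ^ 2) = p := by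
    rw [div_eq_iff (by positivity), hcQ]
    linear_combination (b : ℚ) ^ 2 * hpQ
  have e2 : -(a : ℚ) * (((a : ℚ) ^ 3 - 1) / (b : ℚ)) = -(a * c) := by
    rw [hcQ, mul_div_cancel_left₀ _ hbQ]
    ring
  rw [cubicPoly, unitCubic, e1, e2]
  push_cast
  rfl

theorem tendsto_log_abs_intCast :
    Tendsto (fun t : ℤ => Real.log |(t : ℝ)|) cofinite atTop :=
  Real.tendsto_log_atTop.comp
    ((tendsto_norm_cocompact_atTop (E := ℝ)).comp Int.tendsto_coe_cofinite)

/-- If `log |x t| ≤ κ log |t|` holds asymptotically with `κ < 1`, then `|x t|` is small in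
comparison with `|t|`. -/
theorem eventually_mul_abs_pow_le {l : Filter ℤ} {x : ℤ → ℤ} {κ : ℝ} (k : ℕ)
    (hl : Tendsto (fun t : ℤ => Real.log |(t : ℝ)|) l atTop)
    (hx0 : ∀ᶠ t in l, 0 < |x t|)
    (hx : Tendsto (fun t : ℤ => Real.log |(x t : ℝ)| / Real.log |(t : ℝ)|) l (𝓝 κ))
    (hκ : k * κ < 1) : ∀ᶠ t in l, 1000 * |x t| ^ k ≤ |t| := by
  have hlim : Tendsto (fun t : ℤ => (1 - k * (Real.log |(x t : ℝ)| / Real.log |(t : ℝ)|)) *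
      Real.log |(t : ℝ)|) l atTop :=
    (tendsto_const_nhds.sub (hx.const_mul _)).pos_mul_atTop (by linarith) hl
  filter_upwards [hlim.eventually_ge_atTop (Real.log 1000), hl.eventually_gt_atTop 0, hx0]
    with t h1 h2 h3
  have hxt : 0 < |(x t : ℝ)| := by exact_mod_cast h3
  have ht : 0 < |(t : ℝ)| := by
    rcases (abs_nonneg (t : ℝ)).eq_or_lt with h | h
    · rw [← h] at h2
      simp at h2
    · exact h
  have h4 : (1 - k * (Real.log |(x t : ℝ)| / Real.log |(t : ℝ)|)) * Real.log |(t : ℝ)| =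
      Real.log |(t : ℝ)| - k * Real.log |(x t : ℝ)| := by
    field_simp
  rw [h4] at h1
  have h5 : Real.log (1000 * |(x t : ℝ)| ^ k) ≤ Real.log |(t : ℝ)| := by
    rw [Real.log_mul (by norm_num) (by positivity), Real.log_pow]
    linarith
  have h6 := (Real.log_le_log_iff (by positivity) ht).1 h5
  exact_mod_cast h6

/-- After division by `log |t|` the expression tends to the positive constant of `hr`. -/
theorem tendsto_combination_atTop {l : Filter ℤ} {a b : ℤ → ℤ} {α β r : ℝ}
    (hl : Tendsto (fun t : ℤ => Real.log |(t : ℝ)|) l atTop)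
    (hα : Tendsto (fun t : ℤ => Real.log |(a t : ℝ)| / Real.log |(t : ℝ)|) l (𝓝 α))
    (hβ : Tendsto (fun t : ℤ => Real.log |(b t : ℝ)| / Real.log |(t : ℝ)|) l (𝓝 β))
    (hr : 0 < 2 / 3 * (1 - r) + (1 / 3 - r) * (α + β)) :
    Tendsto (fun t : ℤ => 2 / 3 * (1 - r) * Real.log |(t : ℝ)| +
      (1 / 3 - r) * (Real.log |(a t : ℝ)| + Real.log |(b t : ℝ)|)) l atTop := by
  have hlim : Tendsto (fun t : ℤ => (2 / 3 * (1 - r) + (1 / 3 - r) *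
      (Real.log |(a t : ℝ)| / Real.log |(t : ℝ)| + Real.log |(b t : ℝ)| / Real.log |(t : ℝ)|)) *
      Real.log |(t : ℝ)|) l atTop :=
    (tendsto_const_nhds.add ((hα.add hβ).const_mul _)).pos_mul_atTop hr hl
  refine hlim.congr' ?_
  filter_upwards [hl.eventually_gt_atTop 0] with t ht
  field_simp

end

theorem mainTheorem3
    (T : Set ℤ) (hT : T.Infinite) (l : Filter ℤ) (hl : l = cofinite ⊓ 𝓟 T)
    (a b : ℤ → ℤ)
    (hcub : ∀ t ∈ T, IsMutuallyCubicRootPair (a t) (b t))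
    (hab : ∀ t ∈ T, 0 < |a t| ∧ |a t| < |b t|)
    (α β : ℝ)
    (hα : Tendsto (fun t : ℤ => Real.log |(a t : ℝ)| / Real.log |(t : ℝ)|) l (𝓝 α))
    (hβ : Tendsto (fun t : ℤ => Real.log |(b t : ℝ)| / Real.log |(t : ℝ)|) l (𝓝 β))
    (hα3 : α < 1 / 3) (hβ1 : β < 1)
    (θ : ℤ → ℝ)
    (hθ : ∀ t ∈ T, aeval (θ t) (cubicPoly (a t) (b t) t) = 0)
    -- `σ t` enumerates the real embeddings of `ℚ(θ t)` whenever there are three of them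
    (σ : ∀ t : ℤ, Fin 3 → (ℚ⟮θ t⟯ →+* ℝ))
    (hσ : ∀ t ∈ T, Nat.card (ℚ⟮θ t⟯ →+* ℝ) = 3 → Function.Bijective (σ t))
    (x : ℤ → LatticeSpace)
    (hx : ∀ t, x t = pointOf (unimodularLattice (σ t) (rootOrder (θ t)))) :
    -- for `|t|` large, `ℚ(θ t)` is a totally real cubic field
    (∀ᶠ t in l, Irreducible (cubicPoly (a t) (b t) t) ∧ Nat.card (ℚ⟮θ t⟯ →+* ℝ) = 3) ∧
    -- fundamental units
    (∀ᶠ t in l, IsFundamentalSystem (σ t) (rootOrder (θ t))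
      ![rootGen (θ t), (a t : ℚ⟮θ t⟯) * rootGen (θ t) - (b t : ℚ⟮θ t⟯)]) ∧
    -- tight simplex sets
    (∃ Φ : ℤ → Fin 3 → E3,
      (∀ᶠ t in l, IsUnitSimplexSet (σ t) (rootOrder (θ t)) (Φ t)) ∧
      ∀ R r : ℝ, 1 ≤ R → 0 ≤ r → r < 1 →
        0 < 2 / 3 * (1 - r) + (1 / 3 - r) * (α + β) →
        ∀ᶠ t in l, IsTight (σ t) (rootOrder (θ t)) R r (Φ t)) ∧
    -- the orbits are compact and carry an invariant probability measure
    (∀ᶠ t in l, IsCompact (diagOrbit (x t)) ∧ ∃ μ, IsOrbitMeasure (x t) μ) ∧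
    -- partial and full escape of mass
    (∀ r : ℝ, 0 < r → r < 1 → 0 < 2 / 3 * (1 - r) + (1 / 3 - r) * (α + β) →
      EscapeOfMass l x (r ^ 2)) ∧
    EscapeOfMass l x (1 / 9) ∧
    (α = 0 → β = 0 → EscapeOfMass l x 1) := by

  have hcof : l ≤ cofinite := hl ▸ inf_le_left
  have hTl : ∀ᶠ t in l, t ∈ T := by
    rw [hl]
    exact mem_inf_of_right (mem_principal_self T)
  have hlog := tendsto_log_abs_intCast.mono_left hcof
  have ha := eventually_mul_abs_pow_le 3 hlog (hTl.mono fun t ht => (hab t ht).1) hα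
    (by push_cast; linarith)
  have hb := eventually_mul_abs_pow_le 1 hlog
    (hTl.mono fun t ht => (hab t ht).1.trans (hab t ht).2) hβ (by push_cast; linarith)
  have hdata : ∀ᶠ t in l, Irreducible (cubicPoly (a t) (b t) t) ∧ Nat.card (ℚ⟮θ t⟯ →+* ℝ) = 3 ∧
      ∃ (c P Q : ℤ) (e : Equiv.Perm (Fin 3)), IsLargeDatum (a t) (b t) t c P Q (σ t) e := by
    filter_upwards [hTl, ha, hb, hlog.eventually_ge_atTop 1000] with t htT hat hbt ht
    rw [pow_one] at hbt
    obtain ⟨c, P, Q, hlarge, hpoly⟩ :=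
      exists_isLargeParameter (hcub t htT) (hab t htT).1 (hab t htT).2 hat hbt
    have hroot := hθ t htT
    rw [hpoly, aeval_unitCubic] at hroot
    have hno := hlarge.no_rational_root
    obtain ⟨r₁, r₂, r₃, hr, -⟩ := hlarge.exists_roots
    have hcard := card_ringHom_eq_three hroot hno hr
    have hdatum : IsCubicDatum (θ t) P Q (σ t) := ⟨hroot, hno, (hσ t htT hcard).1⟩
    obtain ⟨e, he⟩ := hlarge.exists_isLogModel hdatum
    rw [hdatum.abs_conjVandermonde_comp e] at he
    exact ⟨hpoly ▸ irreducible_unitCubic hno, hcard, c, P, Q, e, hlarge, hdatum, ht, he⟩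
  have hescape : ∀ r : ℝ, 0 < r → r < 1 → 0 < 2 / 3 * (1 - r) + (1 / 3 - r) * (α + β) →
      EscapeOfMass l x (r ^ 2) := by
    intro r hr0 hr1 hr
    refine escapeOfMass_of_forall_isCompact (pow_le_one₀ hr0.le hr1.le) fun K hK => ?_
    obtain ⟨ε, hε, hKε⟩ := exists_le_norm_of_isCompact hK
    have hlim := tendsto_combination_atTop hlog hα hβ hr
    filter_upwards [hdata, hlim.eventually_gt_atTop (8 - Real.log (ε / 2))]
      with t ⟨_, _, c, P, Q, e, hd⟩ ht μ hμ
    rw [hx t] at hμ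
    refine hd.measure_le hK.measurableSet hr0.le hr1.le hKε ?_ hμ
    rw [mul_comm, ← lt_div_iff₀ two_pos, ← Real.lt_log_iff_exp_lt (by positivity)]
    linarith
  refine ⟨hdata.mono fun t ht => ⟨ht.1, ht.2.1⟩, ?_, ?_, ?_, hescape, ?_, ?_⟩
  · filter_upwards [hdata] with t ⟨_, _, c, P, Q, e, hd⟩
    exact hd.isFundamentalSystem
  · refine ⟨fun t => unitSimplex (σ t) (rootGen (θ t)) (a t * rootGen (θ t) - b t), ?_, ?_⟩
    · filter_upwards [hdata] with t ⟨_, _, c, P, Q, e, hd⟩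
      exact hd.isUnitSimplexSet
    · intro R r hR hr0 hr1 hr
      have hlim := tendsto_combination_atTop hlog hα hβ hr
      filter_upwards [hdata, hlim.eventually_ge_atTop 9] with t ⟨_, _, c, P, Q, e, hd⟩ ht
      exact hd.isTight hR hr0 hr1 ht
  · filter_upwards [hdata] with t ⟨_, _, c, P, Q, e, hd⟩
    rw [hx t]
    exact hd.isCompact_and_exists
  -- At `r = 1/3` the term with `α + β` vanishes and the inequality holds for all admissible
  -- exponents.
  · have := hescape (1 / 3) (by norm_num) (by norm_num) (by norm_num)
    norm_num at this
    exact this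
  -- Every `r < 1` is now allowed, so one and the same `ν` satisfies all the bounds `1 - r²`; let
  -- `r` tend to `1`.
  · intro hα0 hβ0 μ hμ ν hν hacc
    have hlim : Tendsto (fun r : ℝ => ENNReal.ofReal (1 - r ^ 2)) (𝓝[<] 1)
        (𝓝 (ENNReal.ofReal (1 - 1))) := by
      have hc : Continuous fun r : ℝ => ENNReal.ofReal (1 - r ^ 2) :=
        ENNReal.continuous_ofReal.comp (by fun_prop)
      have := (hc.tendsto 1).mono_left (nhdsWithin_le_nhds (s := Set.Iio 1))
      simpa using this
    refine ge_of_tendsto hlim ?_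
    filter_upwards [Ioo_mem_nhdsLT (show (0 : ℝ) < 1 by norm_num)] with r hr
    refine hescape r hr.1 hr.2 ?_ μ hμ ν hν hacc
    rw [hα0, hβ0]
    linarith [hr.2]
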